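/- Let $\mathcal S$ be a finite-dimensional commutative associative real algebra with identity, $\mathcal S_c=\mathbf C\otimes_{\mathbf R}\mathcal S$ its complexification, and $l=\dim_{\mathbf R}\mathcal S$. A map between open subsets of $\mathcal S_c^M$ and $\mathcal S_c^N$ is called $\mathcal S$-holomorphic near a point $P$ if near $P$ it is the sum of a convergent power series $\sum_\alpha c_\alpha (Z-P)^\alpha$ in the $M$ algebraic variables $Z=(Z_1,\dots,Z_M)$ with coefficients $c_\alpha\in\mathcal S_c^N$. Let $Q=\{\operatorname{Im} w=\Phi(z,\bar z,\operatorname{Re} w)\}\subset\mathbf C^n\times\mathbf C^k$ be a model surface: the coordinates carry positive integer weights, and each $\Phi_j$ is a real polynomial without linear terms that is quasi-homogeneous of the weight of $w_j$. Let $Q$ be nondegenerate: the coordinates of $\Phi$ are linearly independent, and no nonzero germ at $0$ of a holomorphic $(1,0)$-field is tangent to $Q$. Let $\mathbf C^n\times\mathbf C^k=\mathbf C^{lN}$ be identified with $\mathcal S_c^N$ by a complex linear isomorphism. Let $\operatorname{aut}Q$ be the real Lie algebra of germs at $0$ of holomorphic vector fields $X=2\operatorname{Re}\big(f(\zeta)\,\partial/\partial\zeta\big)$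 tangent to $Q$, and $\operatorname{aut}_{\mathcal S}Q$ the set of those $X\in\operatorname{aut}Q$ whose coefficient map $f$ is $\mathcal S$-holomorphic near $0$. For $X\in\operatorname{aut}Q$, $\exp X$ denotes the time-one map of the flow of $X$: it is taken on a connected open neighbourhood of $0$, and the flow is taken in a connected open neighbourhood of $0$ to which $X$ extends as a holomorphic field tangent to $Q$. Let $\operatorname{Aut}Q$ be the local group generated by all $\exp X$, $X\in\operatorname{aut}Q$: its elements are biholomorphic maps of connected open neighbourhoods of $0$ onto open sets, and products and inverses are formed whenever they are defined on a connected neighbourhood of $0$. Let $\operatorname{Aut}_{\mathcal S}Q$ be the set of those elements of $\operatorname{Aut}Q$ that are $\mathcal S$-holomorphic near $0$. Then: (a) $\operatorname{aut}_{\mathcal S}Q$ is a Lie subalgebra of the real Lie algebra $\operatorname{aut}Q$. (b) $\operatorname{Aut}_{\mathcal S}Q$ is a subgroup of the local group $\operatorname{Aut}Q$: it contains the identity, and it contains the products and inverses of its elements whenever these are defined. Moreover, the local group generated by all $\exp X$, $X\in\operatorname{aut}_{\mathcal S}Q$, is a subgroup of $\operatorname{Aut}_{\mathcal S}Q$; in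 particular, these maps $\exp X$ are $\mathcal S$-holomorphic. (c) The flow of an ordinary differential equation with an $\mathcal S$-holomorphic right-hand side is $\mathcal S$-holomorphic: if $F$ is an $\mathcal S$-holomorphic map of a neighbourhood of $0$ in $\mathcal S_c^N$ to $\mathcal S_c^N$, then there is a map $\Psi(T,Z)$ with values in $\mathcal S_c^N$, $\mathcal S$-holomorphic near $0$ in the $N+1$ variables $T\in\mathcal S_c$, $Z\in\mathcal S_c^N$, such that $\Psi(0,Z)=Z$ for $Z$ near $0$ and $\frac{d}{ds}\big|_{s=0}\Psi(T+s\cdot 1,Z)=F(\Psi(T,Z))$, $s\in\mathbf C$, for $(T,Z)$ near $0$. -/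

import Mathlib

open scoped TensorProduct Topology

noncomputable section

namespace CRAlg

/-! ### The complexified algebra and power series over it -/

section Algebra

variable (S : Type*) [CommRing S] [Algebra ℝ S] [FiniteDimensional ℝ S]

/-- The complexification `S_c = ℂ ⊗ S` of a finite-dimensional commutative real algebra `S`. -/
def Complexification : Type _ := ℂ ⊗[ℝ] S

instance : CommRing (Complexification S) := inferInstanceAs (CommRing (ℂ ⊗[ℝ] S))

instance : Algebra ℂ (Complexification S) := inferInstanceAs (Algebra ℂ (ℂ ⊗[ℝ] S))

/-- The complex coordinates `S_c ≃ ℂ^l`, `l = dim S`, given by a real basis of `S`. -/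
def Complexification.coords :
    Complexification S ≃ₗ[ℂ] (Fin (Module.finrank ℝ S) → ℂ) :=
  (Algebra.TensorProduct.basis ℂ (Module.finBasis ℝ S)).equivFun

/-- The norm of `S_c` given by these coordinates. As `S_c` has finite dimension, any other norm
gives the same neighbourhoods and the same convergent series. -/
instance : NormedAddCommGroup (Complexification S) :=
  NormedAddCommGroup.induced _ (Fin (Module.finrank ℝ S) → ℂ)
    (Complexification.coords S).toLinearMap (Complexification.coords S).injective

instance : NormedSpace ℂ (Complexification S) :=
  NormedSpace.induced ℂ _ (Fin (Module.finrank ℝ S) → ℂ) (Complexification.coords S).toLinearMap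

variable {S}

/-- Near the point `P`, the map `F : S_c^M → S_c^N` is the sum of a power series
`∑ c_α (Z - P)^α` in `M` algebraic variables with coefficients `c_α` in `S_c^N`. -/
def SAnalyticAt {M N : ℕ} (F : (Fin M → Complexification S) → (Fin N → Complexification S))
    (P : Fin M → Complexification S) : Prop :=
  ∃ c : (Fin M → ℕ) → (Fin N → Complexification S),
    ∀ᶠ H in 𝓝 (0 : Fin M → Complexification S),
      HasSum (fun α : Fin M → ℕ => (∏ i, H i ^ α i) • c α) (F (P + H))

/-- `S`-holomorphy in a neighbourhood of zero. -/
def SHolomorphicNearZero {M N : ℕ}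
    (F : (Fin M → Complexification S) → (Fin N → Complexification S)) : Prop :=
  SAnalyticAt F 0

end Algebra

/-! ### Germs at zero of holomorphic vector fields -/

section Fields

variable (V : Type*) [NormedAddCommGroup V] [NormedSpace ℂ V]

/-- The real vector space of germs at zero of holomorphic maps `V → V`. -/
def holGerms : Submodule ℝ (Filter.Germ (𝓝 (0 : V)) V) where
  carrier := {X | ∃ f : V → V, AnalyticAt ℂ f 0 ∧ X = (f : Filter.Germ (𝓝 (0 : V)) V)}
  add_mem' := by
    rintro _ _ ⟨f, hf, rfl⟩ ⟨g, hg, rfl⟩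
    exact ⟨f + g, hf.add hg, rfl⟩
  zero_mem' := ⟨0, analyticAt_const, rfl⟩
  smul_mem' := by
    rintro c _ ⟨f, hf, rfl⟩
    refine ⟨(fun _ : V => (c : ℂ)) • f, analyticAt_const.smul hf, ?_⟩
    have h : (fun _ : V => (c : ℂ)) • f = c • f := by
      ext x
      exact Complex.coe_smul c (f x)
    rw [h]
    rfl

theorem mem_holGerms {X : Filter.Germ (𝓝 (0 : V)) V} : X ∈ holGerms V ↔
    ∃ f : V → V, AnalyticAt ℂ f 0 ∧ X = (f : Filter.Germ (𝓝 (0 : V)) V) := Iff.rfl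

/-- Germs at zero of holomorphic real vector fields `2 Re (f(ζ) ∂/∂ζ)` on `V`. Such a field is
given by the germ of the holomorphic map `f : V → V`; as a real vector field on `V` it has the
value `f(p)` at `p`. -/
def HolField : Type _ := holGerms V

instance : AddCommGroup (HolField V) := inferInstanceAs (AddCommGroup (holGerms V))

instance : Module ℝ (HolField V) := inferInstanceAs (Module ℝ (holGerms V))

variable {V}

/-- The germ of a holomorphic vector field. -/
def HolField.mk (f : V → V) (hf : AnalyticAt ℂ f 0) : HolField V :=
  (⟨(f : Filter.Germ (𝓝 (0 : V)) V), (mem_holGerms V).2 ⟨f, hf, rfl⟩⟩ : holGerms V)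

/-- A chosen representative of a germ. -/
def HolField.rep (X : HolField V) : V → V := ((mem_holGerms V).1 X.2).choose

theorem HolField.analyticAt_rep (X : HolField V) : AnalyticAt ℂ X.rep 0 :=
  ((mem_holGerms V).1 X.2).choose_spec.1

theorem HolField.mk_rep (X : HolField V) : HolField.mk X.rep X.analyticAt_rep = X :=
  Subtype.ext ((mem_holGerms V).1 X.2).choose_spec.2.symm

theorem HolField.mk_eq_mk {f g : V → V} {hf : AnalyticAt ℂ f 0} {hg : AnalyticAt ℂ g 0} :
    HolField.mk f hf = HolField.mk g hg ↔ f =ᶠ[𝓝 0] g :=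
  Subtype.ext_iff.trans Filter.Germ.coe_eq

theorem HolField.rep_mk {f : V → V} (hf : AnalyticAt ℂ f 0) :
    (HolField.mk f hf).rep =ᶠ[𝓝 0] f :=
  HolField.mk_eq_mk.1 (HolField.mk_rep (HolField.mk f hf))

theorem HolField.mk_add_mk {f g : V → V} (hf : AnalyticAt ℂ f 0) (hg : AnalyticAt ℂ g 0) :
    HolField.mk f hf + HolField.mk g hg = HolField.mk (f + g) (hf.add hg) := rfl

theorem HolField.smul_mk (c : ℝ) {f : V → V} (hf : AnalyticAt ℂ f 0) :
    c • HolField.mk f hf =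
      HolField.mk ((fun _ : V => (c : ℂ)) • f) (analyticAt_const.smul hf) := by
  have h : (fun _ : V => (c : ℂ)) • f = c • f := by
    ext x
    exact Complex.coe_smul c (f x)
  refine Subtype.ext ?_
  change ((c • f : V → V) : Filter.Germ (𝓝 (0 : V)) V) =
    (((fun _ : V => (c : ℂ)) • f : V → V) : Filter.Germ (𝓝 (0 : V)) V)
  rw [h]

theorem HolField.ind {p : HolField V → Prop} (h : ∀ f hf, p (HolField.mk f hf))
    (X : HolField V) : p X :=
  X.mk_rep ▸ h _ _

variable [CompleteSpace V]

theorem analyticAt_lieBracket {f g : V → V} (hf : AnalyticAt ℂ f 0) (hg : AnalyticAt ℂ g 0) :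
    AnalyticAt ℂ (VectorField.lieBracket ℂ f g) 0 :=
  (((ContinuousLinearMap.id ℂ (V →L[ℂ] V)).analyticAt_bilinear (fderiv ℂ g 0, f 0)).comp₂
    hg.fderiv hf).sub
  (((ContinuousLinearMap.id ℂ (V →L[ℂ] V)).analyticAt_bilinear (fderiv ℂ f 0, g 0)).comp₂
    hf.fderiv hg)

/-- The commutator of vector fields: `[X, Y] = DY(X) - DX(Y)`. -/
instance : Bracket (HolField V) (HolField V) where
  bracket X Y := HolField.mk (VectorField.lieBracket ℂ X.rep Y.rep)
    (analyticAt_lieBracket X.analyticAt_rep Y.analyticAt_rep)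

theorem HolField.mk_lie_mk {f g : V → V} (hf : AnalyticAt ℂ f 0) (hg : AnalyticAt ℂ g 0) :
    ⁅HolField.mk f hf, HolField.mk g hg⁆ =
      HolField.mk (VectorField.lieBracket ℂ f g) (analyticAt_lieBracket hf hg) :=
  HolField.mk_eq_mk.2 ((HolField.rep_mk hf).lieBracket_vectorField (HolField.rep_mk hg))

instance : LieRing (HolField V) where
  add_lie X Y Z := by
    induction X using HolField.ind with | h f hf
    induction Y using HolField.ind with | h g hg
    induction Z using HolField.ind with | h k hk
    simp only [HolField.mk_lie_mk, HolField.mk_add_mk]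
    refine HolField.mk_eq_mk.2 ?_
    filter_upwards [hf.eventually_analyticAt, hg.eventually_analyticAt] with x h1 h2
    exact VectorField.lieBracket_add_left h1.differentiableAt h2.differentiableAt
  lie_add X Y Z := by
    induction X using HolField.ind with | h f hf
    induction Y using HolField.ind with | h g hg
    induction Z using HolField.ind with | h k hk
    simp only [HolField.mk_lie_mk, HolField.mk_add_mk]
    refine HolField.mk_eq_mk.2 ?_
    filter_upwards [hg.eventually_analyticAt, hk.eventually_analyticAt] with x h1 h2
    exact VectorField.lieBracket_add_right h1.differentiableAt h2.differentiableAt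
  lie_self X := by
    induction X using HolField.ind with | h f hf
    rw [HolField.mk_lie_mk]
    have h0 : AnalyticAt ℂ (0 : V → V) 0 := analyticAt_const
    have h : HolField.mk (0 : V → V) h0 = 0 := rfl
    rw [← h, HolField.mk_eq_mk, VectorField.lieBracket_self]
  leibniz_lie X Y Z := by
    induction X using HolField.ind with | h f hf
    induction Y using HolField.ind with | h g hg
    induction Z using HolField.ind with | h k hk
    simp only [HolField.mk_lie_mk, HolField.mk_add_mk]
    refine HolField.mk_eq_mk.2 ?_
    filter_upwards [hf.eventually_analyticAt, hg.eventually_analyticAt,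
      hk.eventually_analyticAt] with x h1 h2 h3
    exact VectorField.leibniz_identity_lieBracket (n := 2) (by simp)
      h1.contDiffAt h2.contDiffAt h3.contDiffAt

instance : LieAlgebra ℝ (HolField V) where
  lie_smul c X Y := by
    induction X using HolField.ind with | h f hf
    induction Y using HolField.ind with | h g hg
    simp only [HolField.smul_mk, HolField.mk_lie_mk]
    refine HolField.mk_eq_mk.2 ?_
    filter_upwards [hg.eventually_analyticAt] with x h1
    exact VectorField.lieBracket_const_smul_right h1.differentiableAt

end Fields

/-! ### Local groups of holomorphic transformations -/

section Groups

variable {V : Type*} [NormedAddCommGroup V] [NormedSpace ℂ V]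

/-- A biholomorphic map of a connected open neighbourhood of zero (its source) onto an open set
(its target). It need not fix zero. -/
structure IsLocalBihol (e : OpenPartialHomeomorph V V) : Prop where
  zero_mem : (0 : V) ∈ e.source
  connected : IsConnected e.source
  holo : AnalyticOnNhd ℂ e e.source
  holo_symm : AnalyticOnNhd ℂ e.symm e.target

/-- `g` is the product `e₂ ∘ e₁` on a connected neighbourhood of zero on which this composition
is defined. -/
structure IsLocalProduct (e₁ e₂ g : OpenPartialHomeomorph V V) : Prop where
  zero_mem : (0 : V) ∈ g.source
  connected : IsConnected g.source
  subset : g.source ⊆ (e₁.trans e₂).source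
  eqOn : Set.EqOn g (e₂ ∘ e₁) g.source

/-- The local group generated by a set of local transformations: all maps obtained from them by
products and inverses, wherever these are defined near zero. -/
inductive LocalGroupGen (G : Set (OpenPartialHomeomorph V V)) :
    OpenPartialHomeomorph V V → Prop
  | of (e : OpenPartialHomeomorph V V) (he : e ∈ G) : LocalGroupGen G e
  | mul (e₁ e₂ g : OpenPartialHomeomorph V V) (h₁ : LocalGroupGen G e₁)
      (h₂ : LocalGroupGen G e₂) (h : IsLocalProduct e₁ e₂ g) : LocalGroupGen G g
  | inv (e : OpenPartialHomeomorph V V) (he : LocalGroupGen G e) (h : (0 : V) ∈ e.target) :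
      LocalGroupGen G e.symm

/-- `H` is a subgroup of the local group `G`: it contains the identity, and products and
inverses of its elements belong to it whenever they are defined near zero. -/
structure IsLocalSubgroup (H G : Set (OpenPartialHomeomorph V V)) : Prop where
  subset : H ⊆ G
  one_mem : OpenPartialHomeomorph.refl V ∈ H
  mul_mem : ∀ e₁ ∈ H, ∀ e₂ ∈ H, ∀ g, IsLocalProduct e₁ e₂ g → g ∈ H
  inv_mem : ∀ e ∈ H, (0 : V) ∈ e.target → e.symm ∈ H

end Groups

/-! ### Model surfaces -/

/-- The space `ℂ^n × ℂ^k` with coordinates `(z, w)`. -/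
abbrev Ambient (n k : ℕ) : Type := (Fin n → ℂ) × (Fin k → ℂ)

/-- The variables of the right-hand side of `Im w = Φ(z, z̄, Re w)`: `Re z_i`, `Im z_i`,
`Re w_j`. -/
abbrev Var (n k : ℕ) : Type := (Fin n ⊕ Fin n) ⊕ Fin k

/-- The values of these variables at a point. -/
def varValue {n k : ℕ} (p : Ambient n k) : Var n k → ℝ :=
  Sum.elim (Sum.elim (fun i => (p.1 i).re) (fun i => (p.1 i).im)) (fun j => (p.2 j).re)

/-- The data of a (weighted) model surface `Im w = Φ(z, z̄, Re w)` of CR-type `(n, k)`: positive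
integer weights of the coordinates, and real polynomials `Φ_j` that are quasi-homogeneous of the
weight of `w_j` and have no linear terms. The last condition says that the tangent space at zero
is `Im w = 0`, so that its complex part, the complex tangent space, is `w = 0`. -/
structure ModelSurface (n k : ℕ) where
  wtz : Fin n → ℕ
  wtw : Fin k → ℕ
  wtz_pos : ∀ i, 0 < wtz i
  wtw_pos : ∀ j, 0 < wtw j
  Φ : Fin k → MvPolynomial (Var n k) ℝ
  homogeneous : ∀ j,
    (Φ j).IsWeightedHomogeneous (Sum.elim (Sum.elim wtz wtz) wtw) (wtw j)
  no_linear : ∀ j s, (Φ j).coeff (Finsupp.single s 1) = 0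

namespace ModelSurface

variable {n k : ℕ} (Q : ModelSurface n k)

/-- The defining functions `Im w_j - Φ_j(z, z̄, Re w)`. -/
def defFun (j : Fin k) (p : Ambient n k) : ℝ :=
  (p.2 j).im - MvPolynomial.eval (varValue p) (Q.Φ j)

/-- The surface as a subset of `ℂ^n × ℂ^k`. -/
def carrier : Set (Ambient n k) := {p | ∀ j, Q.defFun j p = 0}

/-- The (real) tangent space at a point of the surface. -/
def tangent (p : Ambient n k) : Set (Ambient n k) :=
  {v | ∀ j, fderiv ℝ (Q.defFun j) p v = 0}

/-- The field with coefficients `f` is tangent to the surface at all points of `U` on it. -/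
def TangentOn (f : Ambient n k → Ambient n k) (U : Set (Ambient n k)) : Prop :=
  ∀ p ∈ U, p ∈ Q.carrier → f p ∈ Q.tangent p

/-- No nonzero germ at zero of a holomorphic `(1,0)`-field `f(ζ) ∂/∂ζ` is tangent to the surface;
tangency of this complex field means that the real vectors `f(p)` and `i f(p)` are both
tangent. -/
def HolomorphicallyNondegenerate : Prop :=
  ∀ f : Ambient n k → Ambient n k, AnalyticAt ℂ f 0 →
    (∃ U ∈ 𝓝 (0 : Ambient n k), Q.TangentOn f U ∧ Q.TangentOn (fun p => Complex.I • f p) U) →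
    f =ᶠ[𝓝 0] 0

/-- Nondegeneracy: the coordinates of `Φ` are linearly independent, and the surface is
holomorphically nondegenerate. -/
structure Nondegenerate : Prop where
  linearIndependent : LinearIndependent ℝ Q.Φ
  holomorphicallyNondegenerate : Q.HolomorphicallyNondegenerate

/-- `aut Q`: the germs at zero of holomorphic vector fields tangent to `Q`. -/
def aut : Set (HolField (Ambient n k)) :=
  {X | ∃ f : Ambient n k → Ambient n k, ∃ hf : AnalyticAt ℂ f 0, X = HolField.mk f hf ∧
    ∃ U ∈ 𝓝 (0 : Ambient n k), Q.TangentOn f U}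

/-- `e = exp X`: the germ `X` extends to a holomorphic field `f` tangent to `Q` on a connected
open neighbourhood `U` of zero, and `e` is a biholomorphic map of a connected neighbourhood of
zero that takes each `p` to the value at time `1` of the solution of `dζ/dt = f(ζ)` in `U` with
`ζ(0) = p`. -/
def IsExp (X : HolField (Ambient n k))
    (e : OpenPartialHomeomorph (Ambient n k) (Ambient n k)) : Prop :=
  IsLocalBihol e ∧
  ∃ (U : Set (Ambient n k)) (f : Ambient n k → Ambient n k) (hf : AnalyticAt ℂ f 0),
    IsOpen U ∧ IsConnected U ∧ 0 ∈ U ∧ AnalyticOnNhd ℂ f U ∧ Q.TangentOn f U ∧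
    X = HolField.mk f hf ∧
    ∀ p ∈ e.source, ∃ γ : ℝ → Ambient n k, γ 0 = p ∧ γ 1 = e p ∧
      ∀ t ∈ Set.Icc (0 : ℝ) 1, γ t ∈ U ∧ HasDerivWithinAt γ (f (γ t)) (Set.Icc 0 1) t

/-- The local group generated by the maps `exp X` for `X` in a set `A` of fields. -/
def expGroup (A : Set (HolField (Ambient n k))) :
    Set (OpenPartialHomeomorph (Ambient n k) (Ambient n k)) :=
  {e | LocalGroupGen {g | ∃ X ∈ A, Q.IsExp X g} e}

/-- `Aut Q`: the local group of holomorphic automorphisms of `Q` generated by `aut Q`. -/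
def Aut : Set (OpenPartialHomeomorph (Ambient n k) (Ambient n k)) := Q.expGroup Q.aut

end ModelSurface

/-! ### `S`-holomorphic fields and automorphisms -/

section SHol

variable {S : Type*} [CommRing S] [Algebra ℝ S] [FiniteDimensional ℝ S] {n k N : ℕ}

/-- `S`-holomorphy in a neighbourhood of zero of a map of `ℂ^n × ℂ^k` to itself, when this space
is identified with `S_c^N` by `ψ`. -/
def SHol (ψ : Ambient n k ≃ₗ[ℂ] (Fin N → Complexification S))
    (f : Ambient n k → Ambient n k) : Prop :=
  SHolomorphicNearZero (fun Z => ψ (f (ψ.symm Z)))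

/-- `aut_S Q`: the fields of `aut Q` whose coefficients are `S`-holomorphic near zero. -/
def ModelSurface.autS (Q : ModelSurface n k)
    (ψ : Ambient n k ≃ₗ[ℂ] (Fin N → Complexification S)) : Set (HolField (Ambient n k)) :=
  {X | X ∈ Q.aut ∧
    ∃ f : Ambient n k → Ambient n k, ∃ hf : AnalyticAt ℂ f 0, X = HolField.mk f hf ∧ SHol ψ f}

/-- `Aut_S Q`: the elements of `Aut Q` that are `S`-holomorphic near zero. -/
def ModelSurface.AutS (Q : ModelSurface n k)
    (ψ : Ambient n k ≃ₗ[ℂ] (Fin N → Complexification S)) :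
    Set (OpenPartialHomeomorph (Ambient n k) (Ambient n k)) :=
  {e | e ∈ Q.Aut ∧ SHol ψ e}

end SHol

end CRAlg

end

noncomputable section

namespace CRAlg

/-! ### Holomorphic maps whose derivatives intertwine two operators -/

section Intertwining

set_option linter.unusedSectionVars false

variable {E F G : Type*} [NormedAddCommGroup E] [NormedSpace ℂ E] [NormedAddCommGroup F]
  [NormedSpace ℂ F] [NormedAddCommGroup G] [NormedSpace ℂ G]
  [CompleteSpace E] [CompleteSpace F] [CompleteSpace G]
  {A : E →L[ℂ] E} {B : F →L[ℂ] F} {C : G →L[ℂ] G}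

/-! The proof rests on a Cauchy–Riemann type criterion (`sAnalyticAt_iff`): a map is the sum of a
power series in the algebraic variables exactly when it is complex analytic and its derivatives near
the point commute with multiplication by every `a` in `S_c`. One direction is termwise
differentiation. In the other, the higher derivatives become `S_c`-multilinear, so the Taylor terms
expand over the standard basis of `S_c^M` into monomials. Through `ψ` this becomes the condition
`IntertwinesAt` for a family of operators on the ambient space.

Commuting with an operator is stable under sums, composition, inversion and Lie brackets, and by the
identity theorem it spreads over connected open sets. With the tangency of brackets of tangent
fields, proved by differentiating along a retraction to `Q`, this gives (a); it also gives products
and inverses in (b).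

For exponentials let `x`, `y`, `z` be trajectories from `p`, `p + h`, `p + A h`. If `A` commutes
with the derivatives of the field, `x + A (y - x)` solves the equation up to `O(‖h‖²)`, so by
Gronwall it ends within `O(‖h‖²)` of `z` (`norm_timeOne_sub_le`). Hence the derivative of the
time-one map commutes with `A` (`fderiv_timeOne_comm`).

For (c), time in the algebra is absorbed into the space: `Ψ(T, Z)` is the space component of the
time-one map of the field `(T, Z) ↦ (0, T F(Z))`. This field vanishes at `0` with a derivative of
square zero, so the inverse function theorem in the space of continuous curves gives an analytic
flow up to time one (`exists_isFlow`). Its derivative is characterised by the variational equation,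
which yields both `S`-holomorphy and the differential equation in `T`. -/

/-- `f` is analytic at `x`, and near `x` its derivatives intertwine the operators `A` and `B`. -/
structure IntertwinesAt (A : E →L[ℂ] E) (B : F →L[ℂ] F) (f : E → F) (x : E) : Prop where
  analyticAt : AnalyticAt ℂ f x
  comm : ∀ᶠ y in 𝓝 x, ∀ h, fderiv ℂ f y (A h) = B (fderiv ℂ f y h)

namespace IntertwinesAt

theorem self_comm {f : E → F} {x : E} (hf : IntertwinesAt A B f x) (h : E) :
    fderiv ℂ f x (A h) = B (fderiv ℂ f x h) := hf.comm.self_of_nhds h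

theorem eventually {f : E → F} {x : E} (hf : IntertwinesAt A B f x) :
    ∀ᶠ y in 𝓝 x, IntertwinesAt A B f y := by
  filter_upwards [hf.analyticAt.eventually_analyticAt, hf.comm.eventually_nhds] with y h1 h2
  exact ⟨h1, h2⟩

theorem congr {f g : E → F} {x : E} (hf : IntertwinesAt A B f x) (hfg : f =ᶠ[𝓝 x] g) :
    IntertwinesAt A B g x := by
  refine ⟨hf.analyticAt.congr hfg, ?_⟩
  filter_upwards [hf.comm, hfg.eventuallyEq_nhds] with y h1 h2 h
  rw [← h2.fderiv_eq, h1]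

theorem of_clm (L : E →L[ℂ] F) (hL : ∀ h, L (A h) = B (L h)) (x : E) :
    IntertwinesAt A B L x :=
  ⟨L.analyticAt x, .of_forall fun y h => by rw [L.fderiv, hL]⟩

theorem id (x : E) : IntertwinesAt A A (fun y : E => y) x :=
  of_clm (A := A) (B := A) (ContinuousLinearMap.id ℂ E) (fun _ => rfl) x

theorem const (c : F) (x : E) : IntertwinesAt A B (fun _ => c) x :=
  ⟨analyticAt_const, .of_forall fun y h => by simp⟩

theorem add {f g : E → F} {x : E} (hf : IntertwinesAt A B f x) (hg : IntertwinesAt A B g x) :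
    IntertwinesAt A B (fun y => f y + g y) x := by
  refine ⟨hf.analyticAt.add hg.analyticAt, ?_⟩
  filter_upwards [hf.eventually, hg.eventually] with y h1 h2 h
  rw [fderiv_fun_add h1.analyticAt.differentiableAt h2.analyticAt.differentiableAt]
  simp [h1.self_comm, h2.self_comm]

theorem comp {g : F → G} {f : E → F} {x : E} (hg : IntertwinesAt B C g (f x))
    (hf : IntertwinesAt A B f x) : IntertwinesAt A C (fun y => g (f y)) x := by
  refine ⟨hg.analyticAt.comp hf.analyticAt, ?_⟩
  filter_upwards [hf.eventually, hf.analyticAt.continuousAt.eventually hg.eventually]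
    with y h1 h2 h
  have := fderiv_comp y h2.analyticAt.differentiableAt h1.analyticAt.differentiableAt
  simp only [Function.comp_def] at this
  simp [this, h1.self_comm, h2.self_comm]

theorem clm_comp (L : F →L[ℂ] G) (hL : ∀ h, L (B h) = C (L h)) {f : E → F} {x : E}
    (hf : IntertwinesAt A B f x) : IntertwinesAt A C (fun y => L (f y)) x :=
  (of_clm L hL (f x)).comp hf

theorem sub {f g : E → F} {x : E} (hf : IntertwinesAt A B f x) (hg : IntertwinesAt A B g x) :
    IntertwinesAt A B (fun y => f y - g y) x := by
  simpa [sub_eq_add_neg] using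
    hf.add (hg.clm_comp (C := B) (-ContinuousLinearMap.id ℂ F) (by simp))

/-- The derivatives of `e` and `e.symm` at corresponding points are mutually inverse, and the
inverse of an intertwining operator intertwines in the other direction. -/
theorem symm {e : OpenPartialHomeomorph E F} {y : F} (hy : y ∈ e.target)
    (he : IntertwinesAt A B e (e.symm y)) (hs : AnalyticAt ℂ e.symm y) :
    IntertwinesAt B A e.symm y := by
  refine ⟨hs, ?_⟩
  filter_upwards [e.open_target.mem_nhds hy, hs.eventually_analyticAt,
    hs.continuousAt.eventually he.eventually] with z hz h1 h2 h
  have hd1 := h1.differentiableAt.hasFDerivAt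
  have hd2 := h2.analyticAt.differentiableAt.hasFDerivAt
  have hl : (fderiv ℂ e (e.symm z)).comp (fderiv ℂ e.symm z) = ContinuousLinearMap.id ℂ F := by
    refine (hd2.comp z hd1).unique ((hasFDerivAt_id z).congr_of_eventuallyEq ?_)
    filter_upwards [e.open_target.mem_nhds hz] with w hw using e.right_inv hw
  have hr : (fderiv ℂ e.symm z).comp (fderiv ℂ e (e.symm z)) = ContinuousLinearMap.id ℂ E := by
    have hd1' : HasFDerivAt e.symm (fderiv ℂ e.symm z) (e (e.symm z)) := by
      rwa [e.right_inv hz]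
    refine (hd1'.comp _ hd2).unique ((hasFDerivAt_id _).congr_of_eventuallyEq ?_)
    filter_upwards [e.open_source.mem_nhds (e.map_target hz)] with w hw using e.left_inv hw
  have hl' : ∀ v, fderiv ℂ e (e.symm z) (fderiv ℂ e.symm z v) = v := fun v =>
    DFunLike.congr_fun hl v
  have hr' : ∀ v, fderiv ℂ e.symm z (fderiv ℂ e (e.symm z) v) = v := fun v =>
    DFunLike.congr_fun hr v
  conv_lhs => rw [← hl' h, ← h2.self_comm, hr']

theorem fderiv_apply_symm {f : E → F} {x : E} (hf : AnalyticAt ℂ f x)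
    (u v : E) : fderiv ℂ (fderiv ℂ f) x u v = fderiv ℂ (fderiv ℂ f) x v u :=
  (ContDiffAt.isSymmSndFDerivAt (n := 2) hf.contDiffAt (by simp)) u v

theorem fderiv_apply_comm {f : E → F} {x : E} (hf : IntertwinesAt A B f x)
    (u v : E) : fderiv ℂ (fderiv ℂ f) x u (A v) = B (fderiv ℂ (fderiv ℂ f) x u v) := by
  have hd : HasFDerivAt (fderiv ℂ f) (fderiv ℂ (fderiv ℂ f) x) x :=
    hf.analyticAt.fderiv.differentiableAt.hasFDerivAt
  have h1 : HasFDerivAt (fun y => fderiv ℂ f y (A v))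
      ((ContinuousLinearMap.apply ℂ F (A v)).comp (fderiv ℂ (fderiv ℂ f) x)) x :=
    (ContinuousLinearMap.apply ℂ F (A v)).hasFDerivAt.comp x hd
  have h2 : HasFDerivAt (fun y => B (fderiv ℂ f y v))
      (B.comp ((ContinuousLinearMap.apply ℂ F v).comp (fderiv ℂ (fderiv ℂ f) x))) x :=
    B.hasFDerivAt.comp x ((ContinuousLinearMap.apply ℂ F v).hasFDerivAt.comp x hd)
  have h3 := h1.unique (h2.congr_of_eventuallyEq (hf.comm.mono fun y hy => hy v))
  exact DFunLike.congr_fun h3 u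

/-- The derivative of `g` in the direction of the field `f`. -/
theorem fderiv_apply {g : E → F} {f : E → E} {x : E}
    (hg : IntertwinesAt A B g x) (hf : IntertwinesAt A A f x) :
    IntertwinesAt A B (fun y => fderiv ℂ g y (f y)) x := by
  refine ⟨((ContinuousLinearMap.id ℂ (E →L[ℂ] F)).analyticAt_bilinear _).comp₂
    hg.analyticAt.fderiv hf.analyticAt, ?_⟩
  filter_upwards [hf.eventually, hg.eventually] with y h1 h2 h
  have := h2.analyticAt.fderiv.differentiableAt.hasFDerivAt.clm_apply
    h1.analyticAt.differentiableAt.hasFDerivAt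
  rw [this.fderiv]
  simp only [add_apply, ContinuousLinearMap.comp_apply,
    ContinuousLinearMap.flip_apply, map_add, h1.self_comm, h2.self_comm]
  -- Here `A` sits in the slot of the outer differentiation, while the commutation rule concerns the
  -- inner one; symmetry of the second derivative exchanges the slots and then restores them.
  rw [fderiv_apply_symm h2.analyticAt, h2.fderiv_apply_comm,
    fderiv_apply_symm h2.analyticAt (f y) h]

theorem lieBracket {f g : E → E} {x : E} (hf : IntertwinesAt A A f x)
    (hg : IntertwinesAt A A g x) : IntertwinesAt A A (VectorField.lieBracket ℂ f g) x :=
  (hg.fderiv_apply hf).sub (hf.fderiv_apply hg)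

/-- For a fixed `h` both sides of the commutation rule are analytic on `U`, so the identity theorem
applies. This carries a condition imposed only near zero to points such as `e₁ 0` or those of a long
trajectory. -/
theorem of_isPreconnected {f : E → F} {U : Set E} (hf : AnalyticOnNhd ℂ f U)
    (hU : IsPreconnected U) (hUo : IsOpen U) {x₀ : E} (hx₀ : x₀ ∈ U)
    (h₀ : IntertwinesAt A B f x₀) {x : E} (hx : x ∈ U) : IntertwinesAt A B f x := by
  refine ⟨hf x hx, ?_⟩
  have key : ∀ y ∈ U, ∀ h, fderiv ℂ f y (A h) = B (fderiv ℂ f y h) := by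
    intro y hy h
    have h1 : AnalyticOnNhd ℂ (fun y => fderiv ℂ f y (A h)) U := fun z hz =>
      ((ContinuousLinearMap.apply ℂ F (A h)).analyticAt _).comp (hf z hz).fderiv
    have h2 : AnalyticOnNhd ℂ (fun y => B (fderiv ℂ f y h)) U := fun z hz =>
      (B.analyticAt _).comp
        (((ContinuousLinearMap.apply ℂ F h).analyticAt _).comp (hf z hz).fderiv)
    exact h1.eqOn_of_preconnected_of_eventuallyEq h2 hU hx₀ (h₀.comm.mono fun y hy => hy h) hy
  filter_upwards [hUo.mem_nhds hx] with y hy using key y hy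

/-- Differentiating the rule of order `n` gives the rule of order `n + 1` in every slot except the
new one, slot `0`. -/
theorem iteratedFDeriv_comm {f : E → F} (n : ℕ) {x : E}
    (hf : IntertwinesAt A B f x) (v : Fin n → E) (i : Fin n) :
    iteratedFDeriv ℂ n f x (Function.update v i (A (v i))) = B (iteratedFDeriv ℂ n f x v) := by
  induction n generalizing x with
  | zero => exact i.elim0
  | succ n ih =>
    have hsucc : ∀ (w : Fin n → E) (j : Fin n) (u : E),
        iteratedFDeriv ℂ (n + 1) f x (Fin.cons u (Function.update w j (A (w j)))) =
          B (iteratedFDeriv ℂ (n + 1) f x (Fin.cons u w)) := by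
      intro w j u
      have hd : HasFDerivAt (iteratedFDeriv ℂ n f) (fderiv ℂ (iteratedFDeriv ℂ n f) x) x :=
        (AnalyticOnNhd.iteratedFDeriv (s := {x}) (fun _ h => h ▸ hf.analyticAt) n x
          rfl).differentiableAt.hasFDerivAt
      have hap : ∀ w' : Fin n → E, HasFDerivAt (fun y => iteratedFDeriv ℂ n f y w')
          ((ContinuousMultilinearMap.apply ℂ (fun _ => E) F w').comp
            (fderiv ℂ (iteratedFDeriv ℂ n f) x)) x := fun w' =>
        (ContinuousMultilinearMap.apply ℂ (fun _ => E) F w').hasFDerivAt.comp x hd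
      have h3 := (hap (Function.update w j (A (w j)))).unique
        ((B.hasFDerivAt.comp x (hap w)).congr_of_eventuallyEq
          (hf.eventually.mono fun y hy => ih hy w j))
      rw [iteratedFDeriv_succ_apply_left, iteratedFDeriv_succ_apply_left]
      exact DFunLike.congr_fun h3 u
    have hlast : ∀ (j : Fin n) (w : Fin (n + 1) → E),
        iteratedFDeriv ℂ (n + 1) f x (Function.update w j.succ (A (w j.succ))) =
          B (iteratedFDeriv ℂ (n + 1) f x w) := by
      intro j w
      have := hsucc (Fin.tail w) j (w 0)
      rwa [Fin.cons_update, Fin.cons_self_tail] at this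
    rcases Fin.eq_zero_or_eq_succ i with rfl | ⟨j, rfl⟩
    -- Slot `0` is the hypothesis itself in order one; in higher order the symmetry of the
    -- derivative exchanges it with slot `1`.
    · rcases n with _ | n
      · have h1 : ∀ w : Fin 1 → E, iteratedFDeriv ℂ 1 f x w = fderiv ℂ f x (w 0) := by
          intro w
          simp [iteratedFDeriv_one_apply]
        simp [h1, hf.self_comm]
      · have hsym := fun w : Fin (n + 2) → E => hf.analyticAt.contDiffAt.iteratedFDeriv_comp_perm
          (x := x) (f := f) w (Equiv.swap 0 1)
        have h1 := hlast 0 (v ∘ Equiv.swap 0 1)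
        rw [hsym] at h1
        rw [← h1, ← hsym]
        congr 1
        ext k
        simp only [Function.comp_apply, Function.update_apply]
        have : (Fin.succ 0 : Fin (n + 2)) = 1 := rfl
        have hk : (Equiv.swap (0 : Fin (n + 2)) 1) k = 0 ↔ k = 1 := by
          rw [Equiv.swap_apply_eq_iff, Equiv.swap_apply_left]
        simp only [this, Equiv.swap_apply_right, hk]
    · exact hlast j v

end IntertwinesAt

end Intertwining

/-! ### Power series over the algebra and linearity of the derivative -/

section PowerSeries

set_option linter.unusedSectionVars false

variable {S : Type*} [CommRing S] [Algebra ℝ S] [FiniteDimensional ℝ S]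

instance : FiniteDimensional ℂ (Complexification S) :=
  (Complexification.coords S).symm.finiteDimensional

/-- The coordinate norm need not be submultiplicative, so products cost a constant. The bound `1 ≤
K` serves to make it positive, also for the zero algebra. -/
theorem Complexification.exists_norm_mul_le :
    ∃ K : ℝ, 1 ≤ K ∧ ∀ a b : Complexification S, ‖a * b‖ ≤ K * ‖a‖ * ‖b‖ := by
  let L : Complexification S →ₗ[ℂ] Complexification S →L[ℂ] Complexification S :=
    LinearMap.toContinuousLinearMap.toLinearMap ∘ₗ LinearMap.mul ℂ (Complexification S)
  have hL : ∀ a b, LinearMap.toContinuousLinearMap L a b = a * b := fun a b => rfl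
  refine ⟨max 1 ‖LinearMap.toContinuousLinearMap L‖, le_max_left _ _, fun a b => ?_⟩
  rw [← hL]
  refine (ContinuousLinearMap.le_opNorm₂ _ a b).trans ?_
  gcongr
  exact le_max_right _ _

variable (S) in
/-- A bound for the multiplication of the algebra. -/
def mulBound : ℝ := (Complexification.exists_norm_mul_le (S := S)).choose

variable (S) in
theorem one_le_mulBound : 1 ≤ mulBound S :=
  (Complexification.exists_norm_mul_le (S := S)).choose_spec.1

variable (S) in
theorem mulBound_pos : 0 < mulBound S := one_pos.trans_le (one_le_mulBound S)

theorem norm_mul_le_mulBound (a b : Complexification S) : ‖a * b‖ ≤ mulBound S * ‖a‖ * ‖b‖ :=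
  (Complexification.exists_norm_mul_le (S := S)).choose_spec.2 a b

/-! ### Monomials over the algebra as multilinear maps. -/

variable {M N : ℕ}

theorem norm_smul_le_mulBound (a : Complexification S) (v : Fin N → Complexification S) :
    ‖a • v‖ ≤ mulBound S * ‖a‖ * ‖v‖ := by
  have := mulBound_pos S
  refine (pi_norm_le_iff_of_nonneg (by positivity)).2 fun i => ?_
  refine (norm_mul_le_mulBound a (v i)).trans ?_
  gcongr
  exact norm_le_pi_norm v i

theorem norm_prod_smul_le {m : ℕ} (x : Fin m → Complexification S)
    (c : Fin N → Complexification S) :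
    ‖(∏ j, x j) • c‖ ≤ mulBound S ^ m * (∏ j, ‖x j‖) * ‖c‖ := by
  induction m with
  | zero => simp
  | succ m ih =>
    rw [Fin.prod_univ_succ, Fin.prod_univ_succ, mul_smul]
    have := mulBound_pos S
    calc _ ≤ mulBound S * ‖x 0‖ * ‖(∏ j, x (Fin.succ j)) • c‖ := norm_smul_le_mulBound _ _
      _ ≤ mulBound S * ‖x 0‖ * (mulBound S ^ m * (∏ j, ‖x (Fin.succ j)‖) * ‖c‖) := by
        gcongr; exact ih _
      _ = _ := by ring

/-- Multiplication by an element of the algebra as an operator on a free module over it. -/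
def smulCLM (N : ℕ) (a : Complexification S) :
    (Fin N → Complexification S) →L[ℂ] (Fin N → Complexification S) :=
  LinearMap.mkContinuous
    ((LinearMap.lsmul (Complexification S) (Fin N → Complexification S) a).restrictScalars ℂ)
    (mulBound S * ‖a‖) (norm_smul_le_mulBound a)

@[simp]
theorem smulCLM_apply (a : Complexification S) (v : Fin N → Complexification S) :
    smulCLM N a v = a • v := rfl

/-- The multilinear map `(v_j) ↦ (∏ (v_j)_{w j}) c` given by a word `w`. -/
def wordMap {m : ℕ} (w : Fin m → Fin M) (c : Fin N → Complexification S) :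
    ContinuousMultilinearMap ℂ (fun _ : Fin m => Fin M → Complexification S)
      (Fin N → Complexification S) :=
  MultilinearMap.mkContinuous
    (((LinearMap.toSpanSingleton (Complexification S) (Fin N → Complexification S)
      c).restrictScalars ℂ).compMultilinearMap
        ((MultilinearMap.mkPiAlgebra ℂ (Fin m) (Complexification S)).compLinearMap
          fun j => LinearMap.proj (w j)))
    (mulBound S ^ m * ‖c‖) (by
      intro v
      refine (norm_prod_smul_le (fun j => v j (w j)) c).trans ?_
      have := mulBound_pos S
      rw [mul_right_comm]
      gcongr with j
      exact norm_le_pi_norm (v j) (w j))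

theorem wordMap_apply {m : ℕ} (w : Fin m → Fin M) (c : Fin N → Complexification S)
    (v : Fin m → Fin M → Complexification S) :
    wordMap w c v = (∏ j, v j (w j)) • c := rfl

theorem norm_wordMap_le {m : ℕ} (w : Fin m → Fin M) (c : Fin N → Complexification S) :
    ‖wordMap w c‖ ≤ mulBound S ^ m * ‖c‖ :=
  MultilinearMap.mkContinuous_norm_le _ (by have := mulBound_pos S; positivity) _

theorem wordMap_update_smul {m : ℕ} (w : Fin m → Fin M) (c : Fin N → Complexification S)
    (v : Fin m → Fin M → Complexification S) (j : Fin m) (a : Complexification S)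
    (h : Fin M → Complexification S) :
    wordMap w c (Function.update v j (a • h)) = a • wordMap w c (Function.update v j h) := by
  have key : ∀ u : Fin M → Complexification S, ∏ i, Function.update v j u i (w i) =
      u (w j) * ∏ i ∈ Finset.univ.erase j, v i (w i) := by
    intro u
    rw [← Finset.mul_prod_erase _ _ (Finset.mem_univ j), Function.update_self]
    congr 1
    refine Finset.prod_congr rfl fun i hi => ?_
    rw [Function.update_of_ne (Finset.ne_of_mem_erase hi)]
  rw [wordMap_apply, wordMap_apply, key, key, Pi.smul_apply, smul_eq_mul, mul_assoc, mul_smul a]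

/-- A word in which the letter `i` occurs `α i` times. -/
def wordOf (α : Fin M → ℕ) : Fin (∑ i, α i) → Fin M := fun j => (finSigmaFinEquiv.symm j).1

theorem prod_wordOf (α : Fin M → ℕ) (H : Fin M → Complexification S) :
    ∏ j, H (wordOf α j) = ∏ i, H i ^ α i := by
  rw [← finSigmaFinEquiv.prod_comp]
  simp [wordOf, Fintype.prod_sigma]

theorem hasDerivAt_wordMap {m : ℕ} (w : Fin m → Fin M) (c : Fin N → Complexification S)
    (H h : Fin M → Complexification S) (z : ℂ) :
    HasDerivAt (fun z : ℂ => wordMap w c (fun _ => H + z • h))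
      (∑ j, wordMap w c (Function.update (fun _ => H + z • h) j h)) z := by
  have h1 : HasDerivAt (fun z : ℂ => (fun _ : Fin m => H + z • h)) (fun _ => h) z := by
    refine hasDerivAt_pi.2 fun _ => ?_
    simpa using ((hasDerivAt_id z).smul_const h).const_add H
  have h2 := ((wordMap w c).hasFDerivAt (x := fun _ : Fin m => H + z • h)).comp_hasDerivAt z h1
  rw [ContinuousMultilinearMap.linearDeriv_apply] at h2
  exact h2

/-! ### From a convergent series to an analytic map with linear derivative. -/

/-- The homogeneous terms of the power series `∑ c_α H^α` as multilinear maps. -/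
def seriesOf (c : (Fin M → ℕ) → Fin N → Complexification S) :
    FormalMultilinearSeries ℂ (Fin M → Complexification S) (Fin N → Complexification S) :=
  fun m => ∑' x : {α : Fin M → ℕ // ∑ i, α i = m},
    (wordMap (wordOf x.1) (c x.1)).domDomCongr (finCongr x.2)

instance (m : ℕ) : Finite {α : Fin M → ℕ // ∑ i, α i = m} :=
  Finite.of_injective
    (f := fun (x : {α : Fin M → ℕ // ∑ i, α i = m}) (i : Fin M) =>
      (⟨x.1 i, Nat.lt_succ_of_le ((Finset.single_le_sum (fun _ _ => Nat.zero_le _)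
        (Finset.mem_univ i)).trans x.2.le)⟩ : Fin (m + 1)))
    (fun x y h => Subtype.ext (funext fun i => by
      simpa using congrFun h i))

/-- At the point with all coordinates equal to a real scalar `t > 0`, the monomial of index `α` is
the scalar `t ^ |α|`. Unconditional convergence in finite dimension is absolute, which bounds the
coefficients. -/
theorem exists_summable_of_hasSum {c : (Fin M → ℕ) → Fin N → Complexification S}
    {F : (Fin M → Complexification S) → Fin N → Complexification S}
    (hF : ∀ᶠ H in 𝓝 (0 : Fin M → Complexification S),
      HasSum (fun α : Fin M → ℕ => (∏ i, H i ^ α i) • c α) (F H)) :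
    ∃ t : ℝ, 0 < t ∧ Summable fun α : Fin M → ℕ => t ^ (∑ i, α i) * ‖c α‖ := by
  have hcont : Filter.Tendsto
      (fun t : ℝ => ((t : ℂ) • (1 : Fin M → Complexification S))) (𝓝 0) (𝓝 0) := by
    have : Continuous (fun t : ℝ => ((t : ℂ) • (1 : Fin M → Complexification S))) := by
      fun_prop
    simpa using this.tendsto 0
  have h1 := (hcont.eventually hF).filter_mono (nhdsWithin_le_nhds (s := Set.Ioi 0))
  obtain ⟨t, ht, htpos⟩ := (h1.and self_mem_nhdsWithin).exists
  have htpos : 0 < t := htpos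
  refine ⟨t, htpos, ?_⟩
  refine ht.summable.norm.congr fun α => ?_
  have h2 : ∏ i, ((t : ℂ) • (1 : Fin M → Complexification S)) i ^ α i =
      algebraMap ℂ (Complexification S) ((t : ℂ) ^ (∑ i, α i)) := by
    simp [Algebra.smul_def, Finset.prod_pow_eq_pow_sum]
  rw [h2, algebraMap_smul, norm_smul, norm_pow, Complex.norm_real, Real.norm_of_nonneg htpos.le]

theorem seriesOf_diag (c : (Fin M → ℕ) → Fin N → Complexification S)
    (H : Fin M → Complexification S) (m : ℕ) :
    HasSum (fun x : {α : Fin M → ℕ // ∑ i, α i = m} => (∏ i, H i ^ x.1 i) • c x.1)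
      (seriesOf c m fun _ => H) := by
  cases nonempty_fintype {α : Fin M → ℕ // ∑ i, α i = m}
  have h : (seriesOf c m fun _ => H) =
      ∑ x : {α : Fin M → ℕ // ∑ i, α i = m}, (∏ i, H i ^ x.1 i) • c x.1 := by
    rw [seriesOf, tsum_fintype, sum_apply]
    refine Finset.sum_congr rfl fun x _ => ?_
    rw [ContinuousMultilinearMap.domDomCongr_apply, wordMap_apply, prod_wordOf]
  rw [h]
  exact hasSum_fintype _

theorem norm_seriesOf_le (c : (Fin M → ℕ) → Fin N → Complexification S) (m : ℕ) :
    ‖seriesOf c m‖ ≤ ∑' x : {α : Fin M → ℕ // ∑ i, α i = m},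
      mulBound S ^ (∑ i, x.1 i) * ‖c x.1‖ := by
  cases nonempty_fintype {α : Fin M → ℕ // ∑ i, α i = m}
  rw [seriesOf, tsum_fintype, tsum_fintype]
  refine (norm_sum_le _ _).trans (Finset.sum_le_sum fun x _ => ?_)
  rw [ContinuousMultilinearMap.norm_domDomCongr]
  exact norm_wordMap_le _ _

/-- The decomposition of multi-indices by degree. -/
def degreeEquiv (M : ℕ) : (Σ m : ℕ, {α : Fin M → ℕ // ∑ i, α i = m}) ≃ (Fin M → ℕ) :=
  Equiv.sigmaFiberEquiv fun α : Fin M → ℕ => ∑ i, α i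

/-- A word map of length `m` costs a factor `mulBound S ^ m`; the radius `t / mulBound S` absorbs
it. -/
theorem seriesOf_radius_pos {c : (Fin M → ℕ) → Fin N → Complexification S} {t : ℝ} (ht : 0 < t)
    (hc : Summable fun α : Fin M → ℕ => t ^ (∑ i, α i) * ‖c α‖) : 0 < (seriesOf c).radius := by
  have hK := mulBound_pos S
  let r : NNReal := ⟨t / mulBound S, by positivity⟩
  have hr : (0 : ENNReal) < r := by
    rw [ENNReal.coe_pos]
    exact div_pos ht hK
  refine hr.trans_le ((seriesOf c).le_radius_of_summable_norm ?_)
  have h1 := ((degreeEquiv M).summable_iff.2 hc).sigma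
  refine Summable.of_nonneg_of_le (fun m => by positivity) (fun m => ?_) h1
  calc ‖seriesOf c m‖ * (r : ℝ) ^ m
      ≤ (∑' x : {α : Fin M → ℕ // ∑ i, α i = m}, mulBound S ^ (∑ i, x.1 i) * ‖c x.1‖) *
          (r : ℝ) ^ m := by
        gcongr
        exact norm_seriesOf_le c m
    _ = ∑' x : {α : Fin M → ℕ // ∑ i, α i = m},
          mulBound S ^ (∑ i, x.1 i) * ‖c x.1‖ * (r : ℝ) ^ m := tsum_mul_right.symm
    _ = _ := by
        refine tsum_congr fun x => ?_
        have : (r : ℝ) = t / mulBound S := rfl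
        simp only [degreeEquiv, Function.comp_apply, Equiv.sigmaFiberEquiv_apply, x.2, this]
        rw [div_pow]
        field_simp

theorem analyticAt_of_hasSum {c : (Fin M → ℕ) → Fin N → Complexification S}
    {F : (Fin M → Complexification S) → Fin N → Complexification S}
    (hF : ∀ᶠ H in 𝓝 (0 : Fin M → Complexification S),
      HasSum (fun α : Fin M → ℕ => (∏ i, H i ^ α i) • c α) (F H)) : AnalyticAt ℂ F 0 := by
  obtain ⟨t, ht, hc⟩ := exists_summable_of_hasSum hF
  have h1 := ((seriesOf c).hasFPowerSeriesOnBall (seriesOf_radius_pos ht hc)).analyticAt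
  refine h1.congr ?_
  filter_upwards [hF] with H hH
  have h2 := ((degreeEquiv M).hasSum_iff.2 hH).sigma (fun m => seriesOf_diag c H m)
  exact h2.tsum_eq

/-- The derivative of each monomial is linear over the algebra, so it suffices to differentiate the
series term by term. -/
theorem eventually_fderiv_smul_of_hasSum {c : (Fin M → ℕ) → Fin N → Complexification S}
    {F : (Fin M → Complexification S) → Fin N → Complexification S}
    (hF : ∀ᶠ H in 𝓝 (0 : Fin M → Complexification S),
      HasSum (fun α : Fin M → ℕ => (∏ i, H i ^ α i) • c α) (F H)) :
    ∀ᶠ H in 𝓝 (0 : Fin M → Complexification S), ∀ (a : Complexification S)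
      (h : Fin M → Complexification S), fderiv ℂ F H (a • h) = a • fderiv ℂ F H h := by
  obtain ⟨t, ht, hc⟩ := exists_summable_of_hasSum hF
  have hK := mulBound_pos S
  have hr : 0 < t / mulBound S := by positivity
  filter_upwards [hF.eventually_nhds, (analyticAt_of_hasSum hF).eventually_analyticAt,
    Metric.ball_mem_nhds 0 hr] with H hH hd hHr a h
  set f : (Fin M → Complexification S) → (Fin M → ℕ) → ℂ → Fin N → Complexification S :=
    fun v α z => wordMap (wordOf α) (c α) (fun _ => H + z • v) with hf
  have key : ∀ v : Fin M → Complexification S,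
      HasSum (fun α => ∑ j, wordMap (wordOf α) (c α) (Function.update (fun _ => H) j v))
        (fderiv ℂ F H v) := by
    intro v
    have hcont : Continuous fun z : ℂ => H + z • v := by fun_prop
    have h0 : Filter.Tendsto (fun z : ℂ => H + z • v) (𝓝 0) (𝓝 H) := by
      simpa using hcont.tendsto 0
    have hbd : ∀ᶠ z : ℂ in 𝓝 0, ‖H + z • v‖ < t / mulBound S :=
      h0.norm.eventually (gt_mem_nhds (by simpa using hHr))
    obtain ⟨ε, hε, hb⟩ := Metric.eventually_nhds_iff_ball.1 hbd
    -- Weierstrass' theorem on the complex line `H + z v`: while `‖H + z v‖ < t / mulBound S`, the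
    -- term of index `α` is at most `t ^ |α| * ‖c α‖`, uniformly in `z`.
    have hsum := Complex.hasSum_deriv_of_summable_norm (F := f v) (z := 0)
      (U := Metric.ball 0 ε) hc
      (fun α z _ => (hasDerivAt_wordMap _ _ H v z).differentiableAt.differentiableWithinAt)
      Metric.isOpen_ball (by
        intro α z hz
        refine ((wordMap (wordOf α) (c α)).le_opNorm _).trans ?_
        have h3 := hb z hz
        calc _ ≤ (mulBound S ^ (∑ i, α i) * ‖c α‖) *
              ∏ _j : Fin (∑ i, α i), (t / mulBound S) := by
              gcongr
              exact norm_wordMap_le _ _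
          _ = _ := by
              rw [Finset.prod_const, Finset.card_univ, Fintype.card_fin, div_pow]
              field_simp) (Metric.mem_ball_self hε)
    have e1 : (fun α => deriv (f v α) 0) = fun α =>
        ∑ j, wordMap (wordOf α) (c α) (Function.update (fun _ => H) j v) := by
      funext α
      simpa using (hasDerivAt_wordMap (wordOf α) (c α) H v 0).deriv
    have e2 : deriv (fun w => ∑' α, f v α w) 0 = fderiv ℂ F H v := by
      have h4 : (fun w => ∑' α, f v α w) =ᶠ[𝓝 0] fun w => F (H + w • v) := by
        filter_upwards [h0.eventually hH] with w hw
        rw [← hw.tsum_eq]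
        exact tsum_congr fun α => by simp only [hf, wordMap_apply, prod_wordOf]
      rw [h4.deriv_eq]
      have h5 : HasDerivAt (fun z : ℂ => H + z • v) v 0 := by
        simpa using ((hasDerivAt_id (0 : ℂ)).smul_const v).const_add H
      have h6 : HasFDerivAt F (fderiv ℂ F H) (H + (0 : ℂ) • v) := by
        simpa using hd.differentiableAt.hasFDerivAt
      exact (h6.comp_hasDerivAt 0 h5).deriv
    rwa [e1, e2] at hsum
  have h7 := (smulCLM N a).hasSum (key h)
  refine (key (a • h)).unique (h7.congr_fun fun α => ?_)
  simp [wordMap_update_smul]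

theorem SAnalyticAt.intertwinesAt {F : (Fin M → Complexification S) → Fin N → Complexification S}
    {P : Fin M → Complexification S} (hF : SAnalyticAt F P) (a : Complexification S) :
    IntertwinesAt (smulCLM M a) (smulCLM N a) F P := by
  obtain ⟨c, hc⟩ := hF
  have h1 : IntertwinesAt (smulCLM M a) (smulCLM N a) (fun H => F (P + H)) (P - P) := by
    rw [sub_self]
    exact ⟨analyticAt_of_hasSum hc, (eventually_fderiv_smul_of_hasSum hc).mono fun y hy => hy a⟩
  simpa using IntertwinesAt.comp (f := fun Z => Z - P) h1
    ((IntertwinesAt.id P).sub (IntertwinesAt.const P P))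

/-! ### From linearity of the derivative back to a power series. -/

theorem iteratedFDeriv_smul_univ
    {F : (Fin M → Complexification S) → Fin N → Complexification S}
    {P : Fin M → Complexification S}
    (hF : ∀ a, IntertwinesAt (smulCLM M a) (smulCLM N a) F P) {m : ℕ}
    (a : Fin m → Complexification S) (v : Fin m → Fin M → Complexification S) :
    iteratedFDeriv ℂ m F P (fun j => a j • v j) = (∏ j, a j) • iteratedFDeriv ℂ m F P v := by
  let q : MultilinearMap (Complexification S) (fun _ : Fin m => Fin M → Complexification S)
      (Fin N → Complexification S) :=
    { toFun := iteratedFDeriv ℂ m F P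
      map_update_add' := fun {inst} v i x y => by
        obtain rfl : inst = instDecidableEqFin m := Subsingleton.elim _ _
        exact (iteratedFDeriv ℂ m F P).map_update_add v i x y
      map_update_smul' := fun {inst} v i b x => by
        obtain rfl : inst = instDecidableEqFin m := Subsingleton.elim _ _
        simpa using (hF b).iteratedFDeriv_comm m (Function.update v i x) i }
  exact q.map_smul_univ a v

theorem finite_words (α : Fin M → ℕ) :
    Finite {x : Σ m : ℕ, Fin m → Fin M // (fun i => Fintype.card {j // x.2 j = i}) = α} := by
  refine Set.Finite.subset (Set.finite_range (Sigma.mk (∑ i, α i))) ?_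
  rintro ⟨m, w⟩ (hw : (fun i => Fintype.card {j // w j = i}) = α)
  obtain rfl : ∑ i, α i = m := by
    rw [← hw, ← Fintype.card_sigma, Fintype.card_congr (Equiv.sigmaFiberEquiv w),
      Fintype.card_fin]
  exact ⟨w, rfl⟩

theorem prod_comp_word (H : Fin M → Complexification S) {m : ℕ} (w : Fin m → Fin M) :
    ∏ j, H (w j) = ∏ i, H i ^ Fintype.card {j // w j = i} := by
  rw [← (Equiv.sigmaFiberEquiv w).prod_comp, Fintype.prod_sigma]
  refine Finset.prod_congr rfl fun i _ => ?_
  rw [Finset.prod_congr rfl fun (x : {j // w j = i}) _ => by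
    rw [Equiv.sigmaFiberEquiv_apply, x.2]]
  simp

/-- Writing `H = ∑ H i • e i`, the `m`-th Taylor term is a sum over words `w` of length `m` of `∏ H
(w j)` times a fixed vector. Words with the same letter counts `α` give the same monomial, and their
vectors add up to `c α`. -/
theorem sAnalyticAt_of_intertwinesAt
    {F : (Fin M → Complexification S) → Fin N → Complexification S}
    {P : Fin M → Complexification S}
    (hF : ∀ a, IntertwinesAt (smulCLM M a) (smulCLM N a) F P) : SAnalyticAt F P := by
  obtain ⟨p, r, hp⟩ := (hF 0).analyticAt
  obtain ⟨ρ, hρ0, hρr⟩ := ENNReal.lt_iff_exists_nnreal_btwn.1 (hp.r_pos.trans_le hp.r_le)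
  have hρ : (0 : ℝ) < ρ := by simpa using hρ0
  obtain ⟨C, hC, hb⟩ := p.norm_le_div_pow_of_pos_of_lt_radius (by simpa using hρ0) hρr
  have hK := mulBound_pos S
  set κ : ℝ := ‖(1 : Complexification S)‖
  let e : Fin M → Fin M → Complexification S := fun i => Pi.single i 1
  have he : ∀ i, ‖e i‖ ≤ κ := fun i => by simp [e, κ, Pi.norm_single]
  -- The coefficients use the iterated derivative and not `p m`: only the former is known to be
  -- multilinear over the algebra, and on the diagonal the two agree up to `m!`.
  let d : (Σ m : ℕ, Fin m → Fin M) → Fin N → Complexification S := fun x =>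
    (x.1.factorial : ℂ)⁻¹ • iteratedFDeriv ℂ x.1 F P fun j => e (x.2 j)
  have hd : ∀ x, ‖d x‖ ≤ C / ρ ^ x.1 * κ ^ x.1 := by
    rintro ⟨m, w⟩
    have h1 : ‖iteratedFDeriv ℂ m F P fun j => e (w j)‖ ≤
        m.factorial * (C / ρ ^ m * κ ^ m) := by
      -- The derivative is a sum of `m!` permuted copies of `p m`, which cancels the factorial in
      -- `d`.
      rw [hp.iteratedFDeriv_eq_sum_of_completeSpace]
      refine (norm_sum_le _ _).trans ((Finset.sum_le_card_nsmul _ _ (C / ρ ^ m * κ ^ m)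
        fun σ _ => ?_).trans_eq ?_)
      · refine ((p m).le_opNorm _).trans ?_
        calc _ ≤ C / ρ ^ m * ∏ _j : Fin m, κ := by
              gcongr
              · exact hb m
              · exact he _
          _ = _ := by simp
      · simp [Finset.card_univ, Fintype.card_perm]
    simp only [d, norm_smul, norm_inv, Complex.norm_natCast]
    rw [inv_mul_le_iff₀ (by positivity)]
    exact h1
  have hterm : ∀ (H : Fin M → Complexification S) (m : ℕ),
      p m (fun _ => H) = ∑ w : Fin m → Fin M, (∏ j, H (w j)) • d ⟨m, w⟩ := by
    intro H m
    have h1 : (m.factorial : ℂ) • p m (fun _ => H) = iteratedFDeriv ℂ m F P fun _ => H := by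
      rw [← hp.factorial_smul H m, Nat.cast_smul_eq_nsmul]
    have h2 : H = ∑ i, H i • e i := by
      ext i
      simp [e, Finset.sum_apply, Pi.single_apply]
    have h3 : (iteratedFDeriv ℂ m F P fun _ => H) =
        ∑ w : Fin m → Fin M, (∏ j, H (w j)) • iteratedFDeriv ℂ m F P fun j => e (w j) := by
      conv_lhs => rw [h2]
      rw [ContinuousMultilinearMap.map_sum]
      exact Finset.sum_congr rfl fun w _ => iteratedFDeriv_smul_univ hF _ _
    have hm : (m.factorial : ℂ) ≠ 0 := by exact_mod_cast m.factorial_ne_zero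
    rw [← inv_smul_smul₀ hm (p m fun _ => H), h1, h3, Finset.smul_sum]
    exact Finset.sum_congr rfl fun w _ => smul_comm _ _ _
  have hc : ∀ α : Fin M → ℕ, ∃ c, HasSum (fun x : {x : Σ m : ℕ, Fin m → Fin M //
      (fun i => Fintype.card {j // x.2 j = i}) = α} => d x) c := fun α => by
    have := finite_words α
    cases nonempty_fintype {x : Σ m : ℕ, Fin m → Fin M //
      (fun i => Fintype.card {j // x.2 j = i}) = α}
    exact ⟨_, hasSum_fintype _⟩
  choose c hc using hc
  refine ⟨c, ?_⟩
  -- There are `M ^ m` words of length `m`, each contributing at most `C * s ^ m` with `s` as set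
  -- below; the series over words is thus geometric of ratio `M * s`.
  have hsmall : ∀ᶠ H in 𝓝 (0 : Fin M → Complexification S),
      M * (mulBound S * ‖H‖ * κ / ρ) < 1 := by
    have h0 : Continuous fun H : Fin M → Complexification S =>
        M * (mulBound S * ‖H‖ * κ / ρ) := by fun_prop
    have := h0.tendsto 0
    simp only [norm_zero, mul_zero, zero_mul, zero_div] at this
    exact this.eventually (gt_mem_nhds one_pos)
  have hball := Metric.eball_mem_nhds (0 : Fin M → Complexification S) hp.r_pos
  filter_upwards [hsmall, hball] with H hs hH
  set s : ℝ := mulBound S * ‖H‖ * κ / ρ with hsdef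
  have hs0 : 0 ≤ s := by positivity
  have hsummable : Summable fun x : Σ m : ℕ, Fin m → Fin M => (∏ j, H (x.2 j)) • d x := by
    have h1 : Summable fun x : Σ m : ℕ, Fin m → Fin M => C * s ^ x.1 := by
      refine (summable_sigma_of_nonneg fun x => by positivity).2
        ⟨fun m => Summable.of_finite, ?_⟩
      refine ((summable_geometric_of_lt_one (by positivity) hs).mul_left C).congr fun m => ?_
      dsimp only
      rw [tsum_fintype, Finset.sum_const, Finset.card_univ, Fintype.card_fun, Fintype.card_fin,
        Fintype.card_fin, nsmul_eq_mul]
      push_cast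
      ring
    refine Summable.of_norm_bounded h1 fun x => ?_
    refine (norm_prod_smul_le _ _).trans ?_
    calc _ ≤ mulBound S ^ x.1 * (∏ _j : Fin x.1, ‖H‖) * (C / ρ ^ x.1 * κ ^ x.1) := by
          gcongr
          · exact norm_le_pi_norm H _
          · exact hd x
      _ = _ := by
          rw [Finset.prod_const, Finset.card_univ, Fintype.card_fin, hsdef, div_pow, mul_pow,
            mul_pow]
          ring
  have htotal : HasSum (fun x : Σ m : ℕ, Fin m → Fin M => (∏ j, H (x.2 j)) • d x)
      (F (P + H)) := by
    refine HasSum.sigma_of_hasSum (g := fun m => p m fun _ => H) (hp.hasSum hH) (fun m => ?_)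
      hsummable
    rw [hterm]
    exact hasSum_fintype _
  -- Absolute convergence over all words permits regrouping by letter counts instead of by length.
  have h1 := (Equiv.sigmaFiberEquiv fun (x : Σ m : ℕ, Fin m → Fin M) (i : Fin M) =>
    Fintype.card {j // x.2 j = i}).hasSum_iff.2 htotal
  refine h1.sigma fun α => ?_
  refine ((smulCLM N (∏ i, H i ^ α i)).hasSum (hc α)).congr_fun fun x => ?_
  obtain ⟨x, rfl⟩ := x
  exact congrArg (· • d x) (prod_comp_word H x.2)

theorem sAnalyticAt_iff {F : (Fin M → Complexification S) → Fin N → Complexification S}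
    {P : Fin M → Complexification S} :
    SAnalyticAt F P ↔ ∀ a, IntertwinesAt (smulCLM M a) (smulCLM N a) F P :=
  ⟨SAnalyticAt.intertwinesAt, sAnalyticAt_of_intertwinesAt⟩

end PowerSeries

/-! ### The time-one map of a flow -/

section Flow

set_option linter.unusedSectionVars false

variable {V : Type*} [NormedAddCommGroup V] [NormedSpace ℂ V] [FiniteDimensional ℂ V]
  [NormedSpace ℝ V] [IsScalarTower ℝ ℂ V]

open Metric Set

/-- Bounds for the first two derivatives on a compact thickening of `K` make the radius and the
constants uniform along a trajectory. -/
theorem exists_lipschitz_tube {f : V → V} {U K : Set V} (hU : IsOpen U)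
    (hf : AnalyticOnNhd ℂ f U) (hK : IsCompact K) (hKU : K ⊆ U) :
    ∃ δ > 0, ∃ L : NNReal, L ≠ 0 ∧ ∃ M : ℝ, 0 ≤ M ∧ ∀ x ∈ K,
      LipschitzOnWith L f (closedBall x δ) ∧
      ∀ y ∈ closedBall x δ, ‖f y - f x - fderiv ℂ f x (y - x)‖ ≤ M * ‖y - x‖ ^ 2 := by
  have : ProperSpace V := FiniteDimensional.proper ℂ V
  obtain ⟨δ, hδ, hsub⟩ := hK.exists_cthickening_subset_open hU hKU
  have hcpt : IsCompact (cthickening δ K) := hK.cthickening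
  have hf1 := hf.fderiv
  obtain ⟨L, hL⟩ := hcpt.exists_bound_of_continuousOn (hf1.continuousOn.mono hsub)
  obtain ⟨M, hM⟩ := hcpt.exists_bound_of_continuousOn (hf1.fderiv.continuousOn.mono hsub)
  -- The summand `1` makes the Lipschitz constant nonzero, since the Gronwall bound used later
  -- divides by it.
  refine ⟨δ, hδ, L.toNNReal + 1, by positivity, max M 0, le_max_right _ _, fun x hx => ?_⟩
  have hball : closedBall x δ ⊆ cthickening δ K := closedBall_subset_cthickening hx δ
  have hd : ∀ y ∈ closedBall x δ, HasFDerivAt f (fderiv ℂ f y) y := fun y hy =>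
    (hf y (hsub (hball hy))).differentiableAt.hasFDerivAt
  have hd1 : ∀ y ∈ closedBall x δ, HasFDerivAt (fderiv ℂ f) (fderiv ℂ (fderiv ℂ f) y) y :=
    fun y hy => (hf1 y (hsub (hball hy))).differentiableAt.hasFDerivAt
  refine ⟨?_, fun y hy => ?_⟩
  · refine Convex.lipschitzOnWith_of_nnnorm_hasFDerivWithin_le (𝕜 := ℂ)
      (fun y hy => (hd y hy).hasFDerivWithinAt) (fun y hy => ?_) (convex_closedBall x δ)
    rw [← NNReal.coe_le_coe, coe_nnnorm]
    push_cast
    have := (hL y (hball hy)).trans (Real.le_coe_toNNReal L)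
    linarith
  · have hsub' : closedBall x ‖y - x‖ ⊆ closedBall x δ :=
      closedBall_subset_closedBall (by rwa [mem_closedBall_iff_norm] at hy)
    have hx' : x ∈ closedBall x ‖y - x‖ := mem_closedBall_self (norm_nonneg _)
    have hy' : y ∈ closedBall x ‖y - x‖ := by simp [dist_eq_norm]
    -- The mean value inequality is used twice on the ball of radius `‖y - x‖`: for `f` minus its
    -- linear part at `x`, and for the derivative of `f`.
    refine (Convex.norm_image_sub_le_of_norm_hasFDerivWithin_le' (𝕜 := ℂ)
      (C := max M 0 * ‖y - x‖) (fun z hz => (hd z (hsub' hz)).hasFDerivWithinAt)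
      (fun z hz => ?_) (convex_closedBall x ‖y - x‖) hx' hy').trans_eq (by ring)
    refine (Convex.norm_image_sub_le_of_norm_hasFDerivWithin_le (𝕜 := ℂ) (C := max M 0)
      (fun u hu => (hd1 u (hsub' hu)).hasFDerivWithinAt)
      (fun u hu => (hM u (hball (hsub' hu))).trans (le_max_left _ _))
      (convex_closedBall x ‖y - x‖) hx' hz).trans ?_
    gcongr
    rwa [mem_closedBall_iff_norm] at hz

theorem hasDerivWithinAt_Ici_of_Icc {x : ℝ → V} {x' : V} {t : ℝ} (ht : t ∈ Ico (0 : ℝ) 1)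
    (hx : HasDerivWithinAt x x' (Icc 0 1) t) : HasDerivWithinAt x x' (Ici t) t :=
  hx.mono_of_mem_nhdsWithin (Icc_mem_nhdsGE_of_mem ht)

/-- Gronwall's inequality applies only while `y` stays in the tube around `x`; a first-exit argument
shows that it never leaves. -/
theorem dist_le_of_trajectories {f : V → V} {x y : ℝ → V} {δ : ℝ} {L : NNReal}
    (hx : ∀ t ∈ Icc (0 : ℝ) 1, HasDerivWithinAt x (f (x t)) (Icc 0 1) t)
    (hy : ∀ t ∈ Icc (0 : ℝ) 1, HasDerivWithinAt y (f (y t)) (Icc 0 1) t)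
    (hf : ∀ t ∈ Icc (0 : ℝ) 1, LipschitzOnWith L f (closedBall (x t) δ))
    (h0 : dist (x 0) (y 0) * Real.exp L < δ) :
    ∀ t ∈ Icc (0 : ℝ) 1, dist (x t) (y t) ≤ dist (x 0) (y 0) * Real.exp L := by
  have hδ : 0 ≤ δ := le_trans (by positivity) h0.le
  have hxc : ContinuousOn x (Icc 0 1) := fun t ht => (hx t ht).continuousWithinAt
  have hyc : ContinuousOn y (Icc 0 1) := fun t ht => (hy t ht).continuousWithinAt
  have key : ∀ T ∈ Icc (0 : ℝ) 1, (∀ t ∈ Ico 0 T, dist (x t) (y t) ≤ δ) →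
      ∀ t ∈ Icc 0 T, dist (x t) (y t) ≤ dist (x 0) (y 0) * Real.exp L := by
    intro T hT hin t ht
    have hsub : Icc 0 T ⊆ Icc (0 : ℝ) 1 := Icc_subset_Icc_right hT.2
    have hsub' : Ico 0 T ⊆ Ico (0 : ℝ) 1 := Ico_subset_Ico_right hT.2
    have h1 := dist_le_of_trajectories_ODE_of_mem (v := fun _ => f) (K := L)
      (s := fun t => closedBall (x t) δ) (f := x) (g := y) (a := 0) (b := T)
      (δ := dist (x 0) (y 0))
      (fun t ht => hf t (Ico_subset_Icc_self (hsub' ht))) (hxc.mono hsub)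
      (fun t ht => hasDerivWithinAt_Ici_of_Icc (hsub' ht) (hx t (Ico_subset_Icc_self (hsub' ht))))
      (fun t ht => mem_closedBall_self hδ) (hyc.mono hsub)
      (fun t ht => hasDerivWithinAt_Ici_of_Icc (hsub' ht) (hy t (Ico_subset_Icc_self (hsub' ht))))
      (fun t ht => by rw [mem_closedBall, dist_comm]; exact hin t ht) le_rfl t ht
    refine h1.trans ?_
    gcongr
    rw [sub_zero]
    exact mul_le_of_le_one_right L.2 (hsub ht).2
  refine key 1 ⟨zero_le_one, le_rfl⟩ fun t ht => ?_
  by_contra! hcon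
  have hclosed : IsCompact (Icc (0 : ℝ) 1 ∩ {s | s ∈ Icc (0 : ℝ) 1 ∧ δ ≤ dist (x s) (y s)}) := by
    refine isCompact_Icc.of_isClosed_subset ?_ inter_subset_left
    have := (continuous_dist.comp_continuousOn
      (hxc.prodMk hyc)).preimage_isClosed_of_isClosed isClosed_Icc (isClosed_Ici (a := δ))
    convert this using 1
    ext s
    simp
  -- At the first time `s` with distance at least `δ`, the estimate on `[0, s]` already gives a
  -- distance below `δ`.
  obtain ⟨s, ⟨hs, -, hs'⟩, hmin⟩ := hclosed.exists_isLeast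
    ⟨t, Ico_subset_Icc_self ht, Ico_subset_Icc_self ht, hcon.le⟩
  refine (hs'.trans (key s hs (fun r hr => ?_) s ⟨hs.1, le_rfl⟩)).not_gt h0
  by_contra! hr'
  have hr1 : r ∈ Icc (0 : ℝ) 1 := ⟨hr.1, hr.2.le.trans hs.2⟩
  exact (hmin ⟨hr1, hr1, hr'.le⟩).not_gt hr.2

/-- The curve `w = x + A (y - x)` starts at `z 0`. Since `A` commutes with the derivative of `f`
along `x`, the linear parts cancel in its defect `w' - f(w)`, leaving two Taylor remainders of sizes
`‖A‖ M (X d)²` and `M (‖A‖ X d)²`, where `X = exp L` and `d = ‖y 0 - x 0‖`. Gronwall turns a defect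
`ε` into a gap `ε (X - 1) / L ≤ ε X / L` at time one. -/
theorem norm_timeOne_sub_le {f : V → V} {A : V →L[ℂ] V} {x y z : ℝ → V} {δ M : ℝ} {L : NNReal}
    (hL : L ≠ 0) (hM : 0 ≤ M)
    (hx : ∀ t ∈ Icc (0 : ℝ) 1, HasDerivWithinAt x (f (x t)) (Icc 0 1) t)
    (hy : ∀ t ∈ Icc (0 : ℝ) 1, HasDerivWithinAt y (f (y t)) (Icc 0 1) t)
    (hz : ∀ t ∈ Icc (0 : ℝ) 1, HasDerivWithinAt z (f (z t)) (Icc 0 1) t)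
    (hA : ∀ t ∈ Icc (0 : ℝ) 1, ∀ h, fderiv ℂ f (x t) (A h) = A (fderiv ℂ f (x t) h))
    (hf : ∀ t ∈ Icc (0 : ℝ) 1, LipschitzOnWith L f (closedBall (x t) δ))
    (hf' : ∀ t ∈ Icc (0 : ℝ) 1, ∀ u ∈ closedBall (x t) δ,
      ‖f u - f (x t) - fderiv ℂ f (x t) (u - x t)‖ ≤ M * ‖u - x t‖ ^ 2)
    (hz0 : z 0 = x 0 + A (y 0 - x 0))
    (h1 : ‖y 0 - x 0‖ * Real.exp L < δ) (h2 : ‖A‖ * ‖y 0 - x 0‖ * Real.exp L < δ) :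
    ‖z 1 - x 1 - A (y 1 - x 1)‖ ≤ (‖A‖ + ‖A‖ ^ 2) * M * Real.exp L ^ 2 / L * Real.exp L *
      ‖y 0 - x 0‖ ^ 2 := by
  set d := ‖y 0 - x 0‖ with hd
  set X := Real.exp L with hX
  have hX0 : 0 < X := Real.exp_pos _
  have hyx : ∀ t ∈ Icc (0 : ℝ) 1, ‖y t - x t‖ ≤ d * X := by
    have := dist_le_of_trajectories hx hy hf (by rwa [dist_comm, dist_eq_norm])
    simpa only [dist_comm, dist_eq_norm, norm_sub_rev (x _)] using this
  have hz0' : ‖z 0 - x 0‖ ≤ ‖A‖ * d := by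
    rw [hz0, add_sub_cancel_left]
    exact A.le_opNorm _
  have hzx : ∀ t ∈ Icc (0 : ℝ) 1, ‖z t - x t‖ ≤ ‖A‖ * d * X := by
    intro t ht
    have := dist_le_of_trajectories hx hz hf (by
      rw [dist_comm, dist_eq_norm]
      exact lt_of_le_of_lt (by gcongr) h2) t ht
    rw [dist_comm, dist_eq_norm, dist_comm, dist_eq_norm] at this
    exact this.trans (by gcongr)
  set w : ℝ → V := fun t => x t + A (y t - x t) with hw
  have hwx : ∀ t ∈ Icc (0 : ℝ) 1, ‖w t - x t‖ ≤ ‖A‖ * d * X := by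
    intro t ht
    rw [hw, add_sub_cancel_left, mul_assoc]
    exact (A.le_opNorm _).trans (by gcongr; exact hyx t ht)
  have hxc : ContinuousOn x (Icc 0 1) := fun t ht => (hx t ht).continuousWithinAt
  have hyc : ContinuousOn y (Icc 0 1) := fun t ht => (hy t ht).continuousWithinAt
  have hzc : ContinuousOn z (Icc 0 1) := fun t ht => (hz t ht).continuousWithinAt
  have hwd : ∀ t ∈ Icc (0 : ℝ) 1,
      HasDerivWithinAt w (f (x t) + A (f (y t) - f (x t))) (Icc 0 1) t := fun t ht =>
    (hx t ht).add ((A.restrictScalars ℝ).hasFDerivAt.comp_hasDerivWithinAt t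
      ((hy t ht).sub (hx t ht)))
  have hwc : ContinuousOn w (Icc 0 1) := fun t ht => (hwd t ht).continuousWithinAt
  have hIco : Ico (0 : ℝ) 1 ⊆ Icc 0 1 := Ico_subset_Icc_self
  have hG := dist_le_of_approx_trajectories_ODE_of_mem (v := fun _ => f) (K := L)
    (s := fun t => closedBall (x t) δ) (f := z) (g := w) (a := 0) (b := 1) (δ := 0)
    (εf := 0) (εg := (‖A‖ + ‖A‖ ^ 2) * M * X ^ 2 * d ^ 2)
    (fun t ht => hf t (hIco ht)) hzc
    (fun t ht => hasDerivWithinAt_Ici_of_Icc ht (hz t (hIco ht)))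
    (fun t ht => by simp)
    (fun t ht => by
      rw [mem_closedBall_iff_norm]; exact (hzx t (hIco ht)).trans h2.le) hwc
    (fun t ht => hasDerivWithinAt_Ici_of_Icc ht (hwd t (hIco ht)))
    (fun t ht => by
      have ht := hIco ht
      have e1 := hf' t ht (w t) (by rw [mem_closedBall_iff_norm]; exact (hwx t ht).trans h2.le)
      have e2 := hf' t ht (y t) (by rw [mem_closedBall_iff_norm]; exact (hyx t ht).trans h1.le)
      have e3 : f (x t) + A (f (y t) - f (x t)) - f (w t) =
          A (f (y t) - f (x t) - fderiv ℂ f (x t) (y t - x t)) -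
          (f (w t) - f (x t) - fderiv ℂ f (x t) (w t - x t)) := by
        rw [map_sub A (f (y t) - f (x t)), ← hA t ht]
        simp only [hw, add_sub_cancel_left]
        abel
      rw [dist_eq_norm, e3]
      calc _ ≤ ‖A‖ * (M * (d * X) ^ 2) + M * (‖A‖ * d * X) ^ 2 := by
            refine (norm_sub_le _ _).trans (add_le_add ((A.le_opNorm _).trans ?_) (e1.trans ?_))
            · gcongr
              exact e2.trans (by gcongr; exact hyx t ht)
            · gcongr
              exact hwx t ht
        _ = _ := by ring)
    (fun t ht => by
      rw [mem_closedBall_iff_norm]; exact (hwx t (hIco ht)).trans h2.le)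
    (by simp [hw, hz0]) 1 ⟨zero_le_one, le_rfl⟩
  have hL' : (0 : ℝ) < L := by positivity
  rw [gronwallBound_of_K_ne_0 hL'.ne', dist_eq_norm] at hG
  simp only [hw, zero_mul, zero_add, sub_zero, mul_one, ← hX] at hG
  rw [← sub_sub] at hG
  refine hG.trans ?_
  calc _ ≤ (‖A‖ + ‖A‖ ^ 2) * M * X ^ 2 * d ^ 2 / L * X := by
        gcongr
        linarith
    _ = _ := by ring

/-- The time-one map of a holomorphic field whose derivatives commute with `A` has derivatives
commuting with `A`. -/
theorem fderiv_timeOne_comm {f e : V → V} {U W : Set V} (hU : IsOpen U)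
    (hf : AnalyticOnNhd ℂ f U) {A : V →L[ℂ] V}
    (hA : ∀ x ∈ U, ∀ h, fderiv ℂ f x (A h) = A (fderiv ℂ f x h)) {p : V} (hW : W ∈ 𝓝 p)
    (he : DifferentiableAt ℂ e p)
    (hγ : ∀ q ∈ W, ∃ γ : ℝ → V, γ 0 = q ∧ γ 1 = e q ∧
      ∀ t ∈ Icc (0 : ℝ) 1, γ t ∈ U ∧ HasDerivWithinAt γ (f (γ t)) (Icc 0 1) t) (h : V) :
    fderiv ℂ e p (A h) = A (fderiv ℂ e p h) := by
  obtain ⟨x, hx0, hx1, hx⟩ := hγ p (mem_of_mem_nhds hW)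
  have hxc : ContinuousOn x (Icc 0 1) := fun t ht => (hx t ht).2.continuousWithinAt
  obtain ⟨δ, hδ, L, hL, M, hM, htube⟩ := exists_lipschitz_tube hU hf
    (isCompact_Icc.image_of_continuousOn hxc) (image_subset_iff.2 fun t ht => (hx t ht).1)
  have c1 : Continuous fun h : V => p + h := by fun_prop
  have c2 : Continuous fun h : V => p + A h := by fun_prop
  have c3 : Continuous fun h : V => ‖h‖ * Real.exp L := by fun_prop
  have c4 : Continuous fun h : V => ‖A‖ * ‖h‖ * Real.exp L := by fun_prop
  -- The trajectories start at `p`, `p + h` and `p + A h`, with `h` so small that the last two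
  -- remain in the tube.
  have hO : (fun h : V => e (p + A h) - e p - A (e (p + h) - e p)) =O[𝓝 0]
      fun h => ‖h - 0‖ ^ 2 := by
    refine Asymptotics.IsBigO.of_bound
      ((‖A‖ + ‖A‖ ^ 2) * M * Real.exp L ^ 2 / L * Real.exp L) ?_
    filter_upwards [(c1.tendsto' 0 p (by simp)).eventually hW,
      (c2.tendsto' 0 p (by simp)).eventually hW,
      (c3.tendsto' 0 0 (by simp)).eventually (gt_mem_nhds hδ),
      (c4.tendsto' 0 0 (by simp)).eventually (gt_mem_nhds hδ)] with h h1 h2 h3 h4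
    obtain ⟨y, hy0, hy1, hy⟩ := hγ _ h1
    obtain ⟨z, hz0, hz1, hz⟩ := hγ _ h2
    have hyx : y 0 - x 0 = h := by rw [hy0, hx0, add_sub_cancel_left]
    have := norm_timeOne_sub_le hL hM (fun t ht => (hx t ht).2) (fun t ht => (hy t ht).2)
      (fun t ht => (hz t ht).2) (fun t ht => hA _ (hx t ht).1)
      (fun t ht => (htube _ (mem_image_of_mem x ht)).1)
      (fun t ht => (htube _ (mem_image_of_mem x ht)).2)
      (by rw [hyx, hz0, hx0]) (by rwa [hyx]) (by rwa [hyx])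
    rw [hyx, hz1, hx1, hy1] at this
    simpa using this
  -- A function that is `O(‖h‖²)` has zero derivative at `0`; the chain rule computes the same
  -- derivative as the commutator of `fderiv ℂ e p` and `A`.
  have h1 := hO.hasFDerivAt (𝕜 := ℂ) one_lt_two
  have hd := he.hasFDerivAt
  have d1 : HasFDerivAt (fun h : V => e (p + A h)) ((fderiv ℂ e p).comp A) 0 := by
    refine HasFDerivAt.comp (g := e) (f := fun h : V => p + A h) (0 : V) (by simpa using hd) ?_
    exact A.hasFDerivAt.const_add p
  have d2 : HasFDerivAt (fun h : V => e (p + h)) (fderiv ℂ e p) 0 := by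
    have := HasFDerivAt.comp (g := e) (f := fun h : V => p + h) (g' := fderiv ℂ e p) (0 : V)
      (by simpa using hd) ((hasFDerivAt_id (𝕜 := ℂ) (0 : V)).const_add p)
    rwa [ContinuousLinearMap.comp_id] at this
  have h2 := (d1.sub_const (e p)).sub (A.hasFDerivAt.comp (0 : V) (d2.sub_const (e p)))
  have h3 := DFunLike.congr_fun (h2.unique h1) h
  simpa [sub_eq_zero] using h3

end Flow

/-! ### Fields tangent to a model surface -/

namespace ModelSurface

variable {n k : ℕ} (Q : ModelSurface n k)

theorem analyticAt_defFun (j : Fin k) (p : Ambient n k) : AnalyticAt ℝ (Q.defFun j) p := by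
  have h1 : AnalyticAt ℝ (fun p : Ambient n k => (p.2 j).im) p :=
    (Complex.imCLM.comp ((ContinuousLinearMap.proj j).comp
      (ContinuousLinearMap.snd ℝ (Fin n → ℂ) (Fin k → ℂ)))).analyticAt p
  have h2 : AnalyticAt ℝ (fun p : Ambient n k => MvPolynomial.aeval (varValue p) (Q.Φ j)) p := by
    refine AnalyticAt.aeval_mvPolynomial (fun i => ?_) (Q.Φ j)
    rcases i with (i | i) | i
    · exact (Complex.reCLM.comp ((ContinuousLinearMap.proj i).comp
        (ContinuousLinearMap.fst ℝ (Fin n → ℂ) (Fin k → ℂ)))).analyticAt p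
    · exact (Complex.imCLM.comp ((ContinuousLinearMap.proj i).comp
        (ContinuousLinearMap.fst ℝ (Fin n → ℂ) (Fin k → ℂ)))).analyticAt p
    · exact (Complex.reCLM.comp ((ContinuousLinearMap.proj i).comp
        (ContinuousLinearMap.snd ℝ (Fin n → ℂ) (Fin k → ℂ)))).analyticAt p
  exact h1.sub h2

theorem hasFDerivAt_defFun (j : Fin k) (p : Ambient n k) :
    HasFDerivAt (Q.defFun j) (fderiv ℝ (Q.defFun j) p) p :=
  (Q.analyticAt_defFun j p).differentiableAt.hasFDerivAt

/-- The vector of imaginary coordinates as a point of the last factor. -/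
def imEmbedding (n k : ℕ) : (Fin k → ℝ) →L[ℝ] Ambient n k :=
  (ContinuousLinearMap.inr ℝ (Fin n → ℂ) (Fin k → ℂ)).comp
    (ContinuousLinearMap.pi fun j =>
      (ContinuousLinearMap.toSpanSingleton ℝ Complex.I).comp (ContinuousLinearMap.proj j))

/-- The projection of the ambient space to the surface along the imaginary directions of the
last coordinates. -/
def retraction (p : Ambient n k) : Ambient n k := p - imEmbedding n k fun j => Q.defFun j p

theorem retraction_mem (p : Ambient n k) : Q.retraction p ∈ Q.carrier := by
  intro j
  -- Only `Im w` is moved, and `Φ` does not depend on it.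
  have hv : varValue (Q.retraction p) = varValue p := by
    funext i
    rcases i with (i | i) | i <;> simp [varValue, retraction, imEmbedding]
  rw [defFun, hv]
  simp [retraction, imEmbedding, defFun]

theorem retraction_of_mem {p : Ambient n k} (hp : p ∈ Q.carrier) : Q.retraction p = p := by
  have : (fun j => Q.defFun j p) = 0 := funext hp
  rw [retraction, this, map_zero, sub_zero]

theorem hasFDerivAt_retraction (p : Ambient n k) :
    HasFDerivAt Q.retraction (ContinuousLinearMap.id ℝ (Ambient n k) -
      (imEmbedding n k).comp (ContinuousLinearMap.pi fun j => fderiv ℝ (Q.defFun j) p)) p :=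
  (hasFDerivAt_id p).sub ((imEmbedding n k).hasFDerivAt.comp p
    (hasFDerivAt_pi.2 fun j => Q.hasFDerivAt_defFun j p))

/-- The composite of `h` with the retraction vanishes near `p`, and the derivative of the retraction
fixes tangent vectors. -/
theorem fderiv_eq_zero_of_tangent {h : Ambient n k → ℝ} {p v : Ambient n k}
    {h' : Ambient n k →L[ℝ] ℝ} (hh : HasFDerivAt h h' p) (hp : p ∈ Q.carrier)
    (h0 : ∀ᶠ q in 𝓝 p, q ∈ Q.carrier → h q = 0) (hv : v ∈ Q.tangent p) : h' v = 0 := by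
  have hr := Q.hasFDerivAt_retraction p
  have h1 : HasFDerivAt (h ∘ Q.retraction) (h'.comp _) p :=
    HasFDerivAt.comp p (by rwa [Q.retraction_of_mem hp]) hr
  have hc : Filter.Tendsto Q.retraction (𝓝 p) (𝓝 p) := by
    simpa [Q.retraction_of_mem hp] using hr.continuousAt.tendsto
  have h2 : h ∘ Q.retraction =ᶠ[𝓝 p] fun _ => 0 := by
    filter_upwards [hc.eventually h0] with q hq using hq (Q.retraction_mem q)
  have h3 := DFunLike.congr_fun (h1.unique ((hasFDerivAt_const (0 : ℝ) p).congr_of_eventuallyEq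
    h2)) v
  have h4 : (fun j => fderiv ℝ (Q.defFun j) p v) = 0 := funext hv
  have h5 : (ContinuousLinearMap.pi fun j => fderiv ℝ (Q.defFun j) p) v = 0 := h4
  simpa [h5] using h3

/-- With `ρ` a defining function, `dρ(g)` vanishes on `Q` and is differentiated along `f`, and
conversely. In the difference the second derivatives of `ρ` cancel by symmetry, leaving `dρ` of the
bracket. -/
theorem lieBracket_mem_tangent {f g : Ambient n k → Ambient n k} {p : Ambient n k}
    (hf : AnalyticAt ℂ f p) (hg : AnalyticAt ℂ g p) (hp : p ∈ Q.carrier)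
    (hft : ∀ᶠ q in 𝓝 p, q ∈ Q.carrier → f q ∈ Q.tangent q)
    (hgt : ∀ᶠ q in 𝓝 p, q ∈ Q.carrier → g q ∈ Q.tangent q) :
    VectorField.lieBracket ℂ f g p ∈ Q.tangent p := by
  intro j
  have hρ := (Q.analyticAt_defFun j p).fderiv.differentiableAt.hasFDerivAt
  have h1 := hρ.clm_apply (hg.differentiableAt.hasFDerivAt.restrictScalars ℝ)
  have h2 := hρ.clm_apply (hf.differentiableAt.hasFDerivAt.restrictScalars ℝ)
  have e1 := Q.fderiv_eq_zero_of_tangent h1 hp (hgt.mono fun q hq hqQ => hq hqQ j)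
    (hft.self_of_nhds hp)
  have e2 := Q.fderiv_eq_zero_of_tangent h2 hp (hft.mono fun q hq hqQ => hq hqQ j)
    (hgt.self_of_nhds hp)
  have hsym := (ContDiffAt.isSymmSndFDerivAt (n := 2) (Q.analyticAt_defFun j p).contDiffAt
    (by simp)) (f p) (g p)
  simp only [add_apply, ContinuousLinearMap.comp_apply, ContinuousLinearMap.flip_apply,
    ContinuousLinearMap.coe_restrictScalars'] at e1 e2
  rw [VectorField.lieBracket, map_sub]
  linarith

theorem eventually_tangent {f : Ambient n k → Ambient n k} {U : Set (Ambient n k)}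
    (hU : U ∈ 𝓝 (0 : Ambient n k)) (hf : Q.TangentOn f U) :
    ∀ᶠ p in 𝓝 (0 : Ambient n k), p ∈ Q.carrier → f p ∈ Q.tangent p :=
  Filter.mem_of_superset hU hf

theorem mk_mem_aut {f : Ambient n k → Ambient n k} (hf : AnalyticAt ℂ f 0)
    (h : ∀ᶠ p in 𝓝 (0 : Ambient n k), p ∈ Q.carrier → f p ∈ Q.tangent p) :
    HolField.mk f hf ∈ Q.aut :=
  ⟨f, hf, rfl, _, h, fun _ hp => hp⟩

/-- The Lie algebra of germs at zero of holomorphic fields tangent to the surface. -/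
def autLieSubalgebra : LieSubalgebra ℝ (HolField (Ambient n k)) where
  carrier := Q.aut
  zero_mem' := Q.mk_mem_aut (f := 0) analyticAt_const (.of_forall fun p _ j => map_zero _)
  add_mem' := by
    rintro _ _ ⟨f, hf, rfl, U, hU, hfU⟩ ⟨g, hg, rfl, W, hW, hgW⟩
    rw [HolField.mk_add_mk]
    refine Q.mk_mem_aut _ ?_
    filter_upwards [Q.eventually_tangent hU hfU, Q.eventually_tangent hW hgW] with p h1 h2 hp j
    rw [Pi.add_apply, map_add, h1 hp j, h2 hp j, add_zero]
  smul_mem' := by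
    rintro c _ ⟨f, hf, rfl, U, hU, hfU⟩
    rw [HolField.smul_mk]
    refine Q.mk_mem_aut _ ?_
    filter_upwards [Q.eventually_tangent hU hfU] with p h1 hp j
    have : ((fun _ : Ambient n k => (c : ℂ)) • f) p = c • f p := Complex.coe_smul c (f p)
    rw [this, map_smul, h1 hp j, smul_zero]
  lie_mem' := by
    rintro _ _ ⟨f, hf, rfl, U, hU, hfU⟩ ⟨g, hg, rfl, W, hW, hgW⟩
    rw [HolField.mk_lie_mk]
    refine Q.mk_mem_aut _ ?_
    filter_upwards [(Q.eventually_tangent hU hfU).eventually_nhds,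
      (Q.eventually_tangent hW hgW).eventually_nhds, hf.eventually_analyticAt,
      hg.eventually_analyticAt] with p h1 h2 h3 h4 hp
    exact Q.lieBracket_mem_tangent h3 h4 hp h1 h2

end ModelSurface

/-! ### `S`-holomorphic fields -/

section SHol

variable {S : Type*} [CommRing S] [Algebra ℝ S] [FiniteDimensional ℝ S] {n k N : ℕ}
  (ψ : Ambient n k ≃ₗ[ℂ] (Fin N → Complexification S))

/-- The action of the algebra on the ambient space. -/
def actionCLM (a : Complexification S) : Ambient n k →L[ℂ] Ambient n k :=
  (ψ.toContinuousLinearEquiv.symm : (Fin N → Complexification S) →L[ℂ] Ambient n k).comp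
    ((smulCLM N a).comp (ψ.toContinuousLinearEquiv : Ambient n k →L[ℂ] _))

variable {ψ}

/-- Multiplication by `a` is transported to the ambient space, where (a) and (b) can be proved
without coordinates in the algebra. -/
theorem sHol_iff {f : Ambient n k → Ambient n k} :
    SHol ψ f ↔ ∀ a, IntertwinesAt (actionCLM ψ a) (actionCLM ψ a) f 0 := by
  let T : Ambient n k →L[ℂ] (Fin N → Complexification S) := ψ.toContinuousLinearEquiv
  let T' : (Fin N → Complexification S) →L[ℂ] Ambient n k := ψ.toContinuousLinearEquiv.symm
  have hT : ∀ a v, T (actionCLM ψ a v) = smulCLM N a (T v) := fun a v =>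
    ψ.apply_symm_apply _
  have hT' : ∀ a v, T' (smulCLM N a v) = actionCLM ψ a (T' v) := fun a v => by
    change ψ.symm (a • v) = ψ.symm (a • ψ (ψ.symm v))
    rw [ψ.apply_symm_apply]
  rw [SHol, SHolomorphicNearZero, sAnalyticAt_iff]
  refine forall_congr' fun a => ⟨fun h => ?_, fun h => ?_⟩
  · have h0 : T 0 = 0 := map_zero T
    have h1 := IntertwinesAt.clm_comp T' (hT' a)
      (IntertwinesAt.comp (f := T) (by rwa [h0]) (IntertwinesAt.of_clm T (hT a) 0))
    refine h1.congr (.of_forall fun p => ?_)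
    change ψ.symm (ψ (f (ψ.symm (ψ p)))) = f p
    simp
  · have h0 : T' 0 = 0 := map_zero T'
    exact IntertwinesAt.clm_comp T (hT a)
      (IntertwinesAt.comp (f := T') (by rwa [h0]) (IntertwinesAt.of_clm T' (hT' a) 0))

theorem SHol.congr {f g : Ambient n k → Ambient n k} (hf : SHol ψ f) (h : f =ᶠ[𝓝 0] g) :
    SHol ψ g :=
  sHol_iff.2 fun a => (sHol_iff.1 hf a).congr h

/-- The Lie algebra of `S`-holomorphic fields tangent to the surface. -/
def ModelSurface.autSLieSubalgebra (Q : ModelSurface n k)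
    (ψ : Ambient n k ≃ₗ[ℂ] (Fin N → Complexification S)) : LieSubalgebra ℝ Q.autLieSubalgebra where
  carrier := {X | (X : HolField (Ambient n k)) ∈ Q.autS ψ}
  zero_mem' := by
    refine ⟨Q.autLieSubalgebra.zero_mem, 0, analyticAt_const, rfl, ?_⟩
    exact sHol_iff.2 fun a => IntertwinesAt.const 0 0
  add_mem' := by
    rintro ⟨_, hX⟩ ⟨_, hY⟩ ⟨_, f, hf, rfl, hfS⟩ ⟨_, g, hg, rfl, hgS⟩
    refine ⟨Q.autLieSubalgebra.add_mem hX hY, f + g, hf.add hg, rfl, ?_⟩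
    exact sHol_iff.2 fun a => (sHol_iff.1 hfS a).add (sHol_iff.1 hgS a)
  smul_mem' := by
    rintro c ⟨_, hX⟩ ⟨_, f, hf, rfl, hfS⟩
    refine ⟨Q.autLieSubalgebra.smul_mem c hX, _, _, HolField.smul_mk c hf, ?_⟩
    exact sHol_iff.2 fun a => (sHol_iff.1 hfS a).clm_comp
      ((c : ℂ) • ContinuousLinearMap.id ℂ (Ambient n k)) fun h => by simp
  lie_mem' := by
    rintro ⟨_, hX⟩ ⟨_, hY⟩ ⟨_, f, hf, rfl, hfS⟩ ⟨_, g, hg, rfl, hgS⟩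
    refine ⟨Q.autLieSubalgebra.lie_mem hX hY, _, analyticAt_lieBracket hf hg,
      HolField.mk_lie_mk hf hg, ?_⟩
    exact sHol_iff.2 fun a => (sHol_iff.1 hfS a).lieBracket (sHol_iff.1 hgS a)

end SHol

/-! ### Local groups of `S`-holomorphic maps -/

section Groups

set_option linter.unusedSectionVars false

variable {V : Type*} [NormedAddCommGroup V] [NormedSpace ℂ V]

namespace IsLocalBihol

theorem refl : IsLocalBihol (OpenPartialHomeomorph.refl V) where
  zero_mem := trivial
  connected := by
    let : NormedSpace ℝ V := NormedSpace.complexToReal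
    exact isConnected_univ
  holo := fun x _ => analyticAt_id
  holo_symm := fun x _ => analyticAt_id

theorem symm {e : OpenPartialHomeomorph V V} (he : IsLocalBihol e) (h : (0 : V) ∈ e.target) :
    IsLocalBihol e.symm where
  zero_mem := h
  connected := by
    rw [e.symm_source, ← e.image_source_eq_target]
    exact he.connected.image e e.continuousOn
  holo := he.holo_symm
  holo_symm := he.holo

end IsLocalBihol

namespace IsLocalProduct

variable {e₁ e₂ g : OpenPartialHomeomorph V V}

theorem mem_source (h : IsLocalProduct e₁ e₂ g) {x : V} (hx : x ∈ g.source) :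
    x ∈ e₁.source ∧ e₁ x ∈ e₂.source := by
  simpa using h.subset hx

theorem eventuallyEq (h : IsLocalProduct e₁ e₂ g) {x : V} (hx : x ∈ g.source) :
    g =ᶠ[𝓝 x] fun y => e₂ (e₁ y) :=
  h.eqOn.eventuallyEq_of_mem (g.open_source.mem_nhds hx)

theorem symm_eqOn (h : IsLocalProduct e₁ e₂ g) {y : V} (hy : y ∈ g.target) :
    e₂.symm y = e₁ (g.symm y) ∧ g.symm y = e₁.symm (e₂.symm y) := by
  have hx := g.map_target hy
  obtain ⟨h1, h2⟩ := h.mem_source hx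
  have h3 : e₂ (e₁ (g.symm y)) = y := (h.eqOn hx).symm.trans (g.right_inv hy)
  have h4 : e₂.symm y = e₁ (g.symm y) := by rw [← e₂.left_inv h2, h3]
  exact ⟨h4, by rw [h4, e₁.left_inv h1]⟩

theorem isLocalBihol (h : IsLocalProduct e₁ e₂ g) (h₁ : IsLocalBihol e₁)
    (h₂ : IsLocalBihol e₂) : IsLocalBihol g where
  zero_mem := h.zero_mem
  connected := h.connected
  holo := fun x hx => by
    obtain ⟨hx1, hx2⟩ := h.mem_source hx
    exact AnalyticAt.congr ((h₂.holo _ hx2).comp (h₁.holo _ hx1)) (h.eventuallyEq hx).symm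
  holo_symm := fun y hy => by
    have hx := g.map_target hy
    obtain ⟨h1, h2⟩ := h.mem_source hx
    have h3 : e₂ (e₁ (g.symm y)) = y := (h.eqOn hx).symm.trans (g.right_inv hy)
    have hy2 : y ∈ e₂.target := h3 ▸ e₂.map_source h2
    have hy1 : e₂.symm y ∈ e₁.target := (h.symm_eqOn hy).1 ▸ e₁.map_source h1
    refine AnalyticAt.congr ((h₁.holo_symm _ hy1).comp (h₂.holo_symm _ hy2)) ?_
    filter_upwards [g.open_target.mem_nhds hy] with z hz using (h.symm_eqOn hz).2.symm

end IsLocalProduct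

/-- Connected sources persist throughout the generated group, which makes the identity theorem
available for all its elements. -/
theorem LocalGroupGen.isLocalBihol {G : Set (OpenPartialHomeomorph V V)}
    (hG : ∀ e ∈ G, IsLocalBihol e) {e : OpenPartialHomeomorph V V} (he : LocalGroupGen G e) :
    IsLocalBihol e := by
  induction he with
  | of e he => exact hG e he
  | mul e₁ e₂ g _ _ h h₁ h₂ => exact h.isLocalBihol h₁ h₂
  | inv e _ h he => exact he.symm h

theorem LocalGroupGen.mono {G H : Set (OpenPartialHomeomorph V V)} (hGH : G ⊆ H)
    {e : OpenPartialHomeomorph V V} (he : LocalGroupGen G e) : LocalGroupGen H e := by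
  induction he with
  | of e he => exact .of e (hGH he)
  | mul e₁ e₂ g _ _ h h₁ h₂ => exact .mul e₁ e₂ g h₁ h₂ h
  | inv e _ h he => exact .inv e he h

end Groups

section SHolGroups

variable {S : Type*} [CommRing S] [Algebra ℝ S] [FiniteDimensional ℝ S] {n k N : ℕ}
  {ψ : Ambient n k ≃ₗ[ℂ] (Fin N → Complexification S)}

theorem SHol.intertwinesAt_of_mem {f : Ambient n k → Ambient n k} {U : Set (Ambient n k)}
    (hf : SHol ψ f) (hU : IsOpen U) (hUc : IsConnected U) (h0 : 0 ∈ U)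
    (hfU : AnalyticOnNhd ℂ f U) (a : Complexification S) {x : Ambient n k} (hx : x ∈ U) :
    IntertwinesAt (actionCLM ψ a) (actionCLM ψ a) f x :=
  IntertwinesAt.of_isPreconnected hfU hUc.isPreconnected hU h0 (sHol_iff.1 hf a) hx

theorem IsLocalBihol.intertwinesAt {e : OpenPartialHomeomorph (Ambient n k) (Ambient n k)}
    (he : IsLocalBihol e) (hS : SHol ψ e) (a : Complexification S) {x : Ambient n k}
    (hx : x ∈ e.source) : IntertwinesAt (actionCLM ψ a) (actionCLM ψ a) e x :=
  hS.intertwinesAt_of_mem e.open_source he.connected he.zero_mem he.holo a hx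

/-- The factor `e₂` is used at `e₁ 0`, which need not be `0`; its `S`-holomorphy is propagated there
along its connected source. -/
theorem IsLocalProduct.sHol {e₁ e₂ g : OpenPartialHomeomorph (Ambient n k) (Ambient n k)}
    (h : IsLocalProduct e₁ e₂ g) (h₁ : IsLocalBihol e₁) (h₂ : IsLocalBihol e₂)
    (hS₁ : SHol ψ e₁) (hS₂ : SHol ψ e₂) : SHol ψ g := by
  refine sHol_iff.2 fun a => ?_
  obtain ⟨hx1, hx2⟩ := h.mem_source h.zero_mem
  exact ((h₂.intertwinesAt hS₂ a hx2).comp (h₁.intertwinesAt hS₁ a hx1)).congr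
    (h.eventuallyEq h.zero_mem).symm

theorem IsLocalBihol.sHol_symm {e : OpenPartialHomeomorph (Ambient n k) (Ambient n k)}
    (he : IsLocalBihol e) (hS : SHol ψ e) (h : (0 : Ambient n k) ∈ e.target) :
    SHol ψ e.symm :=
  sHol_iff.2 fun a => (he.intertwinesAt hS a (e.map_target h)).symm h (he.holo_symm 0 h)

namespace ModelSurface

variable (Q : ModelSurface n k)

theorem isLocalBihol_of_mem_expGroup {A : Set (HolField (Ambient n k))}
    {e : OpenPartialHomeomorph (Ambient n k) (Ambient n k)} (he : e ∈ Q.expGroup A) :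
    IsLocalBihol e :=
  LocalGroupGen.isLocalBihol (G := {g | ∃ X ∈ A, Q.IsExp X g}) (fun _ ⟨_, _, h⟩ => h.1) he

theorem isExp_zero : Q.IsExp 0 (OpenPartialHomeomorph.refl (Ambient n k)) :=
  ⟨IsLocalBihol.refl, Set.univ, 0, analyticAt_const, isOpen_univ, isConnected_univ, trivial,
    fun _ _ => analyticAt_const, fun _ _ _ _ => map_zero _, rfl, fun p _ =>
    ⟨fun _ => p, rfl, rfl, fun t _ => ⟨trivial, hasDerivWithinAt_const t _ p⟩⟩⟩

theorem refl_mem_expGroup {A : Set (HolField (Ambient n k))} (hA : 0 ∈ A) :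
    OpenPartialHomeomorph.refl (Ambient n k) ∈ Q.expGroup A :=
  .of _ ⟨0, hA, Q.isExp_zero⟩

/-- The exponential of an `S`-holomorphic field is `S`-holomorphic. -/
theorem IsExp.sHol {Q : ModelSurface n k} {X : HolField (Ambient n k)}
    {e : OpenPartialHomeomorph (Ambient n k) (Ambient n k)} (he : Q.IsExp X e)
    (hX : X ∈ Q.autS ψ) : SHol ψ e := by
  obtain ⟨hbi, U, f, hf, hU, hUc, h0, hfU, -, rfl, hγ⟩ := he
  obtain ⟨-, g, hg, hfg, hgS⟩ := hX
  -- The extension `f` in the definition of `exp` and the `S`-holomorphic representative `g` agree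
  -- only as germs; connectedness of `U` then gives commutation along whole trajectories.
  have hfS : SHol ψ f := hgS.congr (HolField.mk_eq_mk.1 hfg).symm
  refine sHol_iff.2 fun a => ⟨hbi.holo 0 hbi.zero_mem, ?_⟩
  filter_upwards [e.open_source.mem_nhds hbi.zero_mem] with p hp h
  exact fderiv_timeOne_comm hU hfU
    (fun x hx => (hfS.intertwinesAt_of_mem hU hUc h0 hfU a hx).self_comm)
    (e.open_source.mem_nhds hp) (hbi.holo p hp).differentiableAt hγ h

theorem sHol_of_mem_expGroup {e : OpenPartialHomeomorph (Ambient n k) (Ambient n k)}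
    (he : e ∈ Q.expGroup (Q.autS ψ)) : SHol ψ e := by
  change LocalGroupGen _ e at he
  have hbi : ∀ {g}, LocalGroupGen {g | ∃ X ∈ Q.autS ψ, Q.IsExp X g} g → IsLocalBihol g :=
    fun h => Q.isLocalBihol_of_mem_expGroup h
  induction he with
  | of e he =>
    obtain ⟨X, hX, he⟩ := he
    exact he.sHol hX
  | mul e₁ e₂ g he₁ he₂ h h₁ h₂ => exact h.sHol (hbi he₁) (hbi he₂) h₁ h₂
  | inv e he h hS => exact (hbi he).sHol_symm hS h

theorem zero_mem_autS : (0 : HolField (Ambient n k)) ∈ Q.autS ψ :=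
  (Q.autSLieSubalgebra ψ).zero_mem

theorem isLocalSubgroup_AutS (ψ : Ambient n k ≃ₗ[ℂ] (Fin N → Complexification S)) :
    IsLocalSubgroup (Q.AutS ψ) Q.Aut where
  subset := fun _ he => he.1
  one_mem := ⟨Q.refl_mem_expGroup Q.autLieSubalgebra.zero_mem,
    Q.isExp_zero.sHol (ψ := ψ) Q.zero_mem_autS⟩
  mul_mem := fun e₁ h₁ e₂ h₂ g h => ⟨.mul e₁ e₂ g h₁.1 h₂.1 h,
    h.sHol (Q.isLocalBihol_of_mem_expGroup h₁.1) (Q.isLocalBihol_of_mem_expGroup h₂.1) h₁.2 h₂.2⟩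
  inv_mem := fun e he h => ⟨.inv e he.1 h,
    (Q.isLocalBihol_of_mem_expGroup he.1).sHol_symm he.2 h⟩

theorem isLocalSubgroup_expGroup_autS
    (ψ : Ambient n k ≃ₗ[ℂ] (Fin N → Complexification S)) :
    IsLocalSubgroup (Q.expGroup (Q.autS ψ)) (Q.AutS ψ) where
  subset := fun _ he =>
    ⟨LocalGroupGen.mono (G := {g | ∃ X ∈ Q.autS ψ, Q.IsExp X g})
      (H := {g | ∃ X ∈ Q.aut, Q.IsExp X g}) (fun _ ⟨X, hX, h⟩ => ⟨X, hX.1, h⟩) he,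
      Q.sHol_of_mem_expGroup he⟩
  one_mem := Q.refl_mem_expGroup Q.zero_mem_autS
  mul_mem := fun e₁ h₁ e₂ h₂ g h => .mul e₁ e₂ g h₁ h₂ h
  inv_mem := fun e he h => .inv e he h

end ModelSurface

end SHolGroups

/-! ### Superposition operators -/

section Superposition

set_option linter.unusedSectionVars false

variable {K E F : Type*} [TopologicalSpace K] [CompactSpace K] [NormedAddCommGroup E]
  [NormedSpace ℂ E] [NormedAddCommGroup F] [NormedSpace ℂ F]

/-- A multilinear map applied pointwise to continuous functions. -/
def pointwiseMultilinear {n : ℕ} (p : ContinuousMultilinearMap ℂ (fun _ : Fin n => E) F) :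
    ContinuousMultilinearMap ℂ (fun _ : Fin n => C(K, E)) C(K, F) :=
  MultilinearMap.mkContinuous
    { toFun := fun u => ⟨fun t => p fun j => u j t, by fun_prop⟩
      map_update_add' := fun u i x y => by
        ext t
        have h : ∀ z : C(K, E), (fun j => (Function.update u i z) j t) =
            Function.update (fun j => u j t) i (z t) := fun z => by
          funext j
          rcases eq_or_ne j i with rfl | hj <;> simp [*]
        simp [h]
      map_update_smul' := fun u i c x => by
        ext t
        have h : ∀ z : C(K, E), (fun j => (Function.update u i z) j t) =
            Function.update (fun j => u j t) i (z t) := fun z => by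
          funext j
          rcases eq_or_ne j i with rfl | hj <;> simp [*]
        simp [h] }
    ‖p‖ (fun u => (ContinuousMap.norm_le _ (by positivity)).2 fun t =>
      (p.le_opNorm _).trans (by
        gcongr with j
        exact (u j).norm_coe_le_norm t))

theorem norm_pointwiseMultilinear_le {n : ℕ}
    (p : ContinuousMultilinearMap ℂ (fun _ : Fin n => E) F) :
    ‖(pointwiseMultilinear p : ContinuousMultilinearMap ℂ (fun _ : Fin n => C(K, E)) _)‖ ≤ ‖p‖ :=
  MultilinearMap.mkContinuous_norm_le _ (norm_nonneg _) _

theorem eventually_forall_apply {P : E → Prop} (hP : ∀ᶠ x in 𝓝 0, P x) :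
    ∀ᶠ u in 𝓝 (0 : C(K, E)), ∀ t, P (u t) := by
  obtain ⟨ε, hε, h⟩ := Metric.eventually_nhds_iff_ball.1 hP
  filter_upwards [Metric.ball_mem_nhds 0 hε] with u hu t
  refine h _ ?_
  rw [mem_ball_zero_iff] at hu ⊢
  exact (u.norm_coe_le_norm t).trans_lt hu

/-- Composition with an analytic map is an analytic map between spaces of continuous functions. -/
theorem exists_superposition [CompleteSpace F] {f : E → F} (hf : AnalyticAt ℂ f 0) :
    ∃ G : C(K, E) → C(K, F), AnalyticAt ℂ G 0 ∧ ∀ᶠ u in 𝓝 0, ∀ t, G u t = f (u t) := by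
  obtain ⟨p, r, hp⟩ := hf
  -- Applying the terms of the series pointwise does not increase their norms, so the radius of
  -- convergence does not shrink.
  let P : FormalMultilinearSeries ℂ C(K, E) C(K, F) := fun n => pointwiseMultilinear (p n)
  have hr : r ≤ P.radius := hp.r_le.trans
    (FormalMultilinearSeries.radius_le_of_le fun n => norm_pointwiseMultilinear_le (p n))
  have hP := P.hasFPowerSeriesOnBall (hp.r_pos.trans_le hr)
  refine ⟨P.sum, hP.analyticAt, ?_⟩
  filter_upwards [Metric.eball_mem_nhds 0 (hp.r_pos.trans_le hr),
    eventually_forall_apply (Metric.eball_mem_nhds 0 hp.r_pos)] with u hu hut t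
  have h1 := (ContinuousMap.evalCLM ℂ t).hasSum (hP.hasSum hu)
  have h2 := hp.hasSum (hut t)
  rw [zero_add] at h1 h2
  exact h1.unique h2

theorem fderiv_superposition {f : E → F} {G : C(K, E) → C(K, F)} {u : C(K, E)}
    (hG : DifferentiableAt ℂ G u) (hGf : ∀ᶠ v in 𝓝 u, ∀ t, G v t = f (v t))
    (hf : ∀ t, DifferentiableAt ℂ f (u t)) (w : C(K, E)) (t : K) :
    fderiv ℂ G u w t = fderiv ℂ f (u t) (w t) := by
  have h1 := (ContinuousMap.evalCLM ℂ (M := F) t).hasFDerivAt.comp u hG.hasFDerivAt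
  have h2 : HasFDerivAt (fun v : C(K, E) => f (v t)) _ u :=
    HasFDerivAt.comp (g := f) u (hf t).hasFDerivAt
      (ContinuousMap.evalCLM ℂ (M := E) t).hasFDerivAt
  exact DFunLike.congr_fun (h1.unique (h2.congr_of_eventuallyEq (hGf.mono fun v hv => hv t))) w

/-- Constant functions. -/
def constCLM (K E : Type*) [TopologicalSpace K] [CompactSpace K] [NormedAddCommGroup E]
    [NormedSpace ℂ E] : E →L[ℂ] C(K, E) :=
  LinearMap.mkContinuous
    { toFun := ContinuousMap.const K
      map_add' := fun _ _ => rfl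
      map_smul' := fun _ _ => rfl } 1
    (fun x => (ContinuousMap.norm_le _ (by positivity)).2 fun _ => by
      rw [one_mul]; exact le_rfl)

@[simp]
theorem constCLM_apply (x : E) (t : K) : constCLM K E x t = x := rfl

end Superposition

/-! ### Analytic flows near a zero of the field -/

section AnalyticFlow

set_option linter.unusedSectionVars false

variable {E : Type*} [NormedAddCommGroup E] [NormedSpace ℂ E] [CompleteSpace E]

open Set intervalIntegral

/-- The space of continuous curves. -/
abbrev Curve (E : Type*) [NormedAddCommGroup E] : Type _ := C(Icc (0 : ℝ) 1, E)

/-- A curve extended by constants to the whole line. -/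
def Curve.extend (u : Curve E) : ℝ → E := Set.IccExtend zero_le_one u

theorem Curve.continuous_extend (u : Curve E) : Continuous u.extend :=
  u.continuous.Icc_extend'

theorem Curve.extend_of_mem (u : Curve E) {t : ℝ} (ht : t ∈ Icc (0 : ℝ) 1) :
    u.extend t = u ⟨t, ht⟩ :=
  IccExtend_of_mem zero_le_one u ht

/-- The primitive of a curve. -/
def primitive (E : Type*) [NormedAddCommGroup E] [NormedSpace ℂ E] [CompleteSpace E] :
    Curve E →L[ℂ] Curve E :=
  LinearMap.mkContinuous
    { toFun := fun u => ⟨fun t => ∫ s in (0 : ℝ)..t, u.extend s,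
        (continuous_primitive (fun _ _ => u.continuous_extend.intervalIntegrable _ _) 0).comp
          continuous_subtype_val⟩
      map_add' := fun u v => by
        ext t
        exact integral_add (u.continuous_extend.intervalIntegrable _ _)
          (v.continuous_extend.intervalIntegrable _ _)
      map_smul' := fun c u => by
        ext t
        exact integral_smul c u.extend } 1
    (fun u => by
      refine (ContinuousMap.norm_le _ (by positivity)).2 fun t => ?_
      refine (norm_integral_le_of_norm_le_const (C := ‖u‖) fun s _ =>
        u.norm_coe_le_norm _).trans ?_
      rw [sub_zero, abs_of_nonneg t.2.1, one_mul]
      exact mul_le_of_le_one_right (norm_nonneg _) t.2.2)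

theorem primitive_apply (u : Curve E) (t : Icc (0 : ℝ) 1) :
    primitive E u t = ∫ s in (0 : ℝ)..t, u.extend s := rfl

theorem primitive_comp (A : E →L[ℂ] E) (u : Curve E) :
    primitive E (A.compLeftContinuous ℂ _ u) = A.compLeftContinuous ℂ _ (primitive E u) := by
  ext t
  exact A.intervalIntegral_comp_comm (u.continuous_extend.intervalIntegrable _ _)

/-- The curves `φ x` solve the equation `u' = f(u)`, `u(0) = x`, on the unit interval and depend
analytically on `x`. The operator of composition with `f` is denoted by `G`. -/
structure IsFlow (f : E → E) (G : Curve E → Curve E) (φ : E → Curve E) : Prop where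
  analyticAt : AnalyticAt ℂ φ 0
  map_zero : φ 0 = 0
  superposition : ∀ᶠ u in 𝓝 0, ∀ t, G u t = f (u t)
  fderiv_superposition : ∀ᶠ u in 𝓝 0, ∀ w t, fderiv ℂ G u w t = fderiv ℂ f (u t) (w t)
  eq_add_primitive : ∀ᶠ x in 𝓝 0, φ x = constCLM _ E x + primitive E (G (φ x))
  -- The variational equation in integral form; the converse implication is uniqueness of its
  -- solution.
  fderiv_eq_iff : ∀ᶠ x in 𝓝 0, ∀ v w,
    fderiv ℂ φ x v = w ↔ w = constCLM _ E v + primitive E (fderiv ℂ G (φ x) w)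
  eq_const : ∀ᶠ x in 𝓝 0, f x = 0 → φ x = constCLM _ E x

/-- The integral equation is `Φ(u) = x` with `Φ(u) = u - ∫ f(u)`, solved near `0` by the analytic
inverse function theorem. The derivative of `Φ` at `0` is `1 - D` with `D² = 0`, hence invertible
with inverse `1 + D`: time one is reached without any smallness of the field. -/
theorem exists_isFlow {f : E → E} (hf : AnalyticAt ℂ f 0) (h0 : f 0 = 0)
    (hnil : ∀ v, fderiv ℂ f 0 (fderiv ℂ f 0 v) = 0) : ∃ G φ, IsFlow f G φ := by
  obtain ⟨G, hG, hGf⟩ := exists_superposition (K := Icc (0 : ℝ) 1) hf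
  have hGd : ∀ᶠ u in 𝓝 (0 : Curve E), ∀ w t,
      fderiv ℂ G u w t = fderiv ℂ f (u t) (w t) := by
    filter_upwards [hG.eventually_analyticAt, hGf.eventually_nhds,
      eventually_forall_apply hf.eventually_analyticAt] with u h1 h2 h3 w t
    exact fderiv_superposition h1.differentiableAt h2 (fun t => (h3 t).differentiableAt) w t
  have hG0 : G 0 = 0 := by
    ext t
    rw [hGf.self_of_nhds t]
    exact h0
  let Φ : Curve E → Curve E := fun u => u - primitive E (G u)
  have hΦ : AnalyticAt ℂ Φ 0 := analyticAt_id.sub (((primitive E).analyticAt _).comp hG)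
  let D : Curve E →L[ℂ] Curve E := (primitive E).comp (fderiv ℂ G 0)
  have hD : ∀ u, D (D u) = 0 := by
    intro u
    -- A constant operator commutes with integration, so `D²` contains the square of `fderiv ℂ f 0`.
    have h1 : D u = (fderiv ℂ f 0).compLeftContinuous ℂ _ (primitive E u) := by
      rw [← primitive_comp]
      refine congrArg (primitive E) ?_
      ext t
      exact hGd.self_of_nhds u t
    have h2 : fderiv ℂ G 0 (D u) = 0 := by
      rw [h1]
      ext t
      rw [hGd.self_of_nhds]
      exact hnil _
    change primitive E (fderiv ℂ G 0 (D u)) = 0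
    rw [h2, _root_.map_zero]
  let I : Curve E ≃L[ℂ] Curve E := ContinuousLinearEquiv.equivOfInverse
    (ContinuousLinearMap.id ℂ _ - D) (ContinuousLinearMap.id ℂ _ + D)
    (fun u => by simp [hD]) (fun u => by simp [hD])
  have hΦd : ∀ u, DifferentiableAt ℂ G u → HasFDerivAt Φ
      (ContinuousLinearMap.id ℂ _ - (primitive E).comp (fderiv ℂ G u)) u := fun u hu =>
    (hasFDerivAt_id u).sub ((primitive E).hasFDerivAt.comp u hu.hasFDerivAt)
  have hI : fderiv ℂ Φ 0 = I := (hΦd 0 hG.differentiableAt).fderiv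
  have hstrict : HasStrictFDerivAt Φ (I : Curve E →L[ℂ] Curve E) 0 := by
    rw [← hI]
    exact hΦ.hasStrictFDerivAt
  let e := hstrict.toOpenPartialHomeomorph Φ
  have he : (e : Curve E → Curve E) = Φ := hstrict.toOpenPartialHomeomorph_coe
  have h0e : (0 : Curve E) ∈ e.source := hstrict.mem_toOpenPartialHomeomorph_source
  have hΦ0 : Φ 0 = 0 := by simp [Φ, hG0]
  have he0 : e 0 = 0 := by rw [he, hΦ0]
  have hes : AnalyticAt ℂ e.symm 0 := by
    have := e.analyticAt_symm' (i := I) h0e (by rwa [he]) (by rw [he, hI])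
    rwa [he0] at this
  have hes0 : e.symm 0 = 0 := by
    conv_lhs => rw [← he0]
    exact e.left_inv h0e
  have h0t : (0 : Curve E) ∈ e.target := he0 ▸ e.map_source h0e
  let φ : E → Curve E := fun x => e.symm (constCLM _ E x)
  have hc : Filter.Tendsto (constCLM (Icc (0 : ℝ) 1) E) (𝓝 0) (𝓝 0) := by
    simpa using (constCLM (Icc (0 : ℝ) 1) E).continuous.tendsto 0
  have hφ0 : φ 0 = 0 := by
    change e.symm (constCLM _ E 0) = 0
    rw [_root_.map_zero, hes0]
  have hφ : AnalyticAt ℂ φ 0 :=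
    AnalyticAt.comp (g := e.symm) (f := constCLM _ E) (by rwa [_root_.map_zero])
      ((constCLM (Icc (0 : ℝ) 1) E).analyticAt 0)
  have hφt : Filter.Tendsto φ (𝓝 0) (𝓝 0) := by
    simpa [hφ0] using hφ.continuousAt.tendsto
  have hinv : ∀ᶠ x in 𝓝 0, Φ (φ x) = constCLM _ E x := by
    filter_upwards [hc.eventually (e.open_target.mem_nhds h0t)] with x hx
    rw [← he]
    exact e.right_inv hx
  refine ⟨G, φ, hφ, hφ0, hGf, hGd, ?_, ?_, ?_⟩
  · filter_upwards [hinv] with x hx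
    rw [← hx]
    simp [Φ]
  · have hesd : ∀ᶠ x in 𝓝 (0 : E), AnalyticAt ℂ e.symm (Φ (φ x)) := by
      have h1 : Filter.Tendsto (fun x => Φ (φ x)) (𝓝 0) (𝓝 0) := by
        refine Filter.Tendsto.comp (g := Φ) ?_ hφt
        simpa [hΦ0] using hΦ.continuousAt.tendsto
      exact h1.eventually hes.eventually_analyticAt
    filter_upwards [hinv.eventually_nhds, hφ.eventually_analyticAt,
      hφt.eventually hG.eventually_analyticAt, hφt.eventually (e.open_source.mem_nhds h0e),
      hesd] with x h1 h2 h3 h4 h5 v w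
    have hd := hΦd (φ x) h3.differentiableAt
    have e1 : HasFDerivAt (fun y => Φ (φ y)) (constCLM _ E) x :=
      (constCLM _ E).hasFDerivAt.congr_of_eventuallyEq h1
    have e2 := DFunLike.congr_fun
      (e1.unique (hd.comp x h2.differentiableAt.hasFDerivAt)) v
    have e3 : HasFDerivAt (fun u => e.symm (Φ u)) (ContinuousLinearMap.id ℂ _) (φ x) := by
      refine (hasFDerivAt_id _).congr_of_eventuallyEq ?_
      filter_upwards [e.open_source.mem_nhds h4] with u hu
      rw [← he]
      exact e.left_inv hu
    have e4 := e3.unique (h5.differentiableAt.hasFDerivAt.comp (φ x) hd)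
    have e2' : constCLM _ E v =
        fderiv ℂ φ x v - primitive E (fderiv ℂ G (φ x) (fderiv ℂ φ x v)) := e2
    refine ⟨?_, fun hw => ?_⟩
    · rintro rfl
      rw [e2']
      abel
    · have e5 : ∀ u, u = fderiv ℂ e.symm (Φ (φ x)) (u - primitive E (fderiv ℂ G (φ x) u)) :=
        fun u => DFunLike.congr_fun e4 u
      rw [e5 (fderiv ℂ φ x v), ← e2', eq_sub_of_add_eq hw.symm]
      exact (e5 w).symm
  · filter_upwards [hc.eventually hGf, hc.eventually (e.open_source.mem_nhds h0e)] with x h1 h2 hx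
    have h3 : G (constCLM _ E x) = 0 := by
      ext t
      rw [h1 t]
      exact hx
    have h4 : e (constCLM _ E x) = constCLM _ E x := by
      rw [he]
      simp [Φ, h3]
    change e.symm (constCLM _ E x) = _
    conv_lhs => rw [← h4]
    exact e.left_inv h2

namespace IsFlow

variable {f : E → E} {G : Curve E → Curve E} {φ : E → Curve E}

theorem tendsto (h : IsFlow f G φ) : Filter.Tendsto φ (𝓝 0) (𝓝 0) := by
  simpa [h.map_zero] using h.analyticAt.continuousAt.tendsto

/-- If `w` solves the variational equation with initial vector `v`, then `A w` solves it with `A v`;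
uniqueness identifies it with the derivative of `φ`. -/
theorem intertwinesAt (h : IsFlow f G φ) {A : E →L[ℂ] E} (hf : IntertwinesAt A A f 0) :
    IntertwinesAt A (A.compLeftContinuous ℂ (Icc (0 : ℝ) 1)) φ 0 := by
  refine ⟨h.analyticAt, ?_⟩
  filter_upwards [h.fderiv_eq_iff, h.tendsto.eventually h.fderiv_superposition,
    h.tendsto.eventually (eventually_forall_apply hf.comm)] with x h1 h2 h3 v
  refine (h1 _ _).2 ?_
  set w := fderiv ℂ φ x v with hw
  have h4 : fderiv ℂ G (φ x) (A.compLeftContinuous ℂ _ w) =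
      A.compLeftContinuous ℂ _ (fderiv ℂ G (φ x) w) := by
    ext t
    rw [h2]
    change _ = A (fderiv ℂ G (φ x) w t)
    rw [h2, ← h3]
    rfl
  rw [h4, primitive_comp]
  conv_lhs => rw [(h1 v w).1 hw.symm, map_add]
  rfl

/-- The curve `w(t) = v + t g(φ(t))` solves the variational equation: `w' = g + t Dg(f) = Df(v) + t
Df(g) = Df(w)`. -/
theorem fderiv_apply (h : IsFlow f G φ) {g : E → E} {v : E} (hg : AnalyticAt ℂ g 0)
    (hfg : ∀ᶠ x in 𝓝 0, fderiv ℂ f x v = g x)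
    (hcomm : ∀ᶠ x in 𝓝 0, fderiv ℂ g x (f x) = fderiv ℂ f x (g x)) :
    ∀ᶠ x in 𝓝 0, ∀ t : Icc (0 : ℝ) 1,
      fderiv ℂ φ x v t = v + ((t : ℝ) : ℂ) • g (φ x t) := by
  filter_upwards [h.fderiv_eq_iff, h.eq_add_primitive, h.tendsto.eventually h.superposition,
    h.tendsto.eventually h.fderiv_superposition,
    h.tendsto.eventually (eventually_forall_apply hg.eventually_analyticAt),
    h.tendsto.eventually (eventually_forall_apply hfg),
    h.tendsto.eventually (eventually_forall_apply hcomm)] with x h1 h2 h3 h4 h5 h6 h7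
  have hw : Continuous fun t : Icc (0 : ℝ) 1 => v + ((t : ℝ) : ℂ) • g (φ x t) := by
    refine continuous_const.add (Continuous.smul (by fun_prop) ?_)
    exact continuous_iff_continuousAt.2 fun t =>
      ContinuousAt.comp (g := g) (h5 t).continuousAt (φ x).continuous.continuousAt
  let w : Curve E := ⟨_, hw⟩
  suffices hsuff : fderiv ℂ φ x v = w from fun t => DFunLike.congr_fun hsuff t
  refine (h1 v w).2 ?_
  -- This extends the curve `φ x` to the line so that it has two-sided derivatives at the endpoints
  -- too.
  let y : ℝ → E := fun t => x + ∫ s in (0 : ℝ)..t, (G (φ x)).extend s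
  have hy : ∀ t (ht : t ∈ Icc (0 : ℝ) 1), y t = φ x ⟨t, ht⟩ := fun t ht => by
    conv_rhs => rw [h2]
    rfl
  have hyd : ∀ t (ht : t ∈ Icc (0 : ℝ) 1), HasDerivAt y (f (φ x ⟨t, ht⟩)) t := fun t ht => by
    have := ((G (φ x)).continuous_extend.integral_hasStrictDerivAt 0 t).hasDerivAt.const_add x
    rwa [(G (φ x)).extend_of_mem ht, h3] at this
  let q : ℝ → E := fun t => (t : ℂ) • g (y t)
  have hq : ∀ t (ht : t ∈ Icc (0 : ℝ) 1),
      HasDerivAt q ((fderiv ℂ G (φ x) w).extend t) t := fun t ht => by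
    rw [Curve.extend_of_mem _ ht, h4]
    have hgd : HasFDerivAt g (fderiv ℂ g (φ x ⟨t, ht⟩)) (y t) := by
      rw [hy t ht]
      exact (h5 _).differentiableAt.hasFDerivAt
    have d1 := (hgd.restrictScalars ℝ).comp_hasDerivAt t (hyd t ht)
    have d2 := (Complex.ofRealCLM.hasDerivAt (x := t)).smul d1
    refine HasDerivAt.congr_deriv (f := q) d2 (Eq.symm ?_)
    change fderiv ℂ f (φ x ⟨t, ht⟩) (v + (t : ℂ) • g (φ x ⟨t, ht⟩)) = _
    rw [map_add, map_smul, h6, ← h7]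
    simp [hy t ht, add_comm]
  ext t
  have hint := integral_eq_sub_of_hasDerivAt_of_le (f := q)
    (f' := (fderiv ℂ G (φ x) w).extend) t.2.1
    (fun s hs => (hq s ⟨hs.1, hs.2.trans t.2.2⟩).continuousAt.continuousWithinAt)
    (fun s hs => hq s ⟨hs.1.le, hs.2.le.trans t.2.2⟩)
    ((fderiv ℂ G (φ x) w).continuous_extend.intervalIntegrable _ _)
  change v + _ = v + primitive E (fderiv ℂ G (φ x) w) t
  rw [primitive_apply, hint]
  simp [q, hy t t.2]

end IsFlow

end AnalyticFlow

/-! ### The flow of an `S`-holomorphic equation with time in the algebra -/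

section AlgebraicTime

variable {S : Type*} [CommRing S] [Algebra ℝ S] [FiniteDimensional ℝ S] {N : ℕ}

/-- Scalar multiplication as a bounded bilinear map. -/
def smulBilin (S : Type*) [CommRing S] [Algebra ℝ S] [FiniteDimensional ℝ S] (N : ℕ) :
    Complexification S →L[ℂ] (Fin N → Complexification S) →L[ℂ] (Fin N → Complexification S) :=
  LinearMap.mkContinuous₂
    (LinearMap.mk₂ ℂ (fun (a : Complexification S) (v : Fin N → Complexification S) => a • v)
      add_smul (fun c a v => smul_assoc c a v) smul_add (fun c a v => smul_comm a c v))
    (mulBound S) norm_smul_le_mulBound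

@[simp]
theorem smulBilin_apply (a : Complexification S) (v : Fin N → Complexification S) :
    smulBilin S N a v = a • v := rfl

/-- The first variable and the remaining ones. -/
def headTail (S : Type*) [CommRing S] [Algebra ℝ S] [FiniteDimensional ℝ S] (N : ℕ) :
    (Fin (N + 1) → Complexification S) →L[ℂ]
      Complexification S × (Fin N → Complexification S) :=
  (ContinuousLinearMap.proj 0).prod
    (ContinuousLinearMap.pi fun i => ContinuousLinearMap.proj (Fin.succ i))

/-- The action of the algebra on the product of the time and space variables. -/
def prodAction (N : ℕ) (a : Complexification S) :
    Complexification S × (Fin N → Complexification S) →L[ℂ]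
      Complexification S × (Fin N → Complexification S) :=
  (LinearMap.toContinuousLinearMap (LinearMap.mulLeft ℂ a)).prodMap (smulCLM N a)

theorem prodAction_apply (a : Complexification S)
    (x : Complexification S × (Fin N → Complexification S)) :
    prodAction N a x = (a * x.1, a • x.2) := rfl

variable {F : (Fin N → Complexification S) → (Fin N → Complexification S)}

/-- The field `(T, Z) ↦ (0, T F(Z))`, whose time-one map solves the equation with the
right-hand side `F`. -/
def suspension (F : (Fin N → Complexification S) → (Fin N → Complexification S))
    (x : Complexification S × (Fin N → Complexification S)) :
    Complexification S × (Fin N → Complexification S) := (0, x.1 • F x.2)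

theorem analyticAt_suspension (hF : AnalyticAt ℂ F 0) : AnalyticAt ℂ (suspension F) 0 :=
  analyticAt_const.prod (((smulBilin S N).analyticAt_bilinear _).comp₂ analyticAt_fst
    (AnalyticAt.comp (f := Prod.snd) hF analyticAt_snd))

theorem fderiv_suspension {x : Complexification S × (Fin N → Complexification S)}
    (hF : DifferentiableAt ℂ F x.2) (h : Complexification S × (Fin N → Complexification S)) :
    fderiv ℂ (suspension F) x h = (0, h.1 • F x.2 + x.1 • fderiv ℂ F x.2 h.2) := by
  have h1 : HasFDerivAt (fun x : Complexification S × (Fin N → Complexification S) => F x.2)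
      ((fderiv ℂ F x.2).comp (ContinuousLinearMap.snd ℂ _ _)) x :=
    HasFDerivAt.comp (f := Prod.snd) x hF.hasFDerivAt hasFDerivAt_snd
  have h2 := ((smulBilin S N).hasFDerivAt.comp x hasFDerivAt_fst).clm_apply h1
  have h3 := ((hasFDerivAt_const (0 : Complexification S) x).prodMk h2).fderiv
  change fderiv ℂ (suspension F) x = _ at h3
  rw [h3]
  simp [add_comm]

theorem exists_algebraic_flow (hF : SHolomorphicNearZero F) :
    ∃ Ψ : (Fin (N + 1) → Complexification S) → (Fin N → Complexification S),
      SHolomorphicNearZero Ψ ∧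
      (∀ᶠ Z in 𝓝 (0 : Fin N → Complexification S), Ψ (Fin.cons 0 Z) = Z) ∧
      ∀ᶠ p in 𝓝 (0 : Complexification S × (Fin N → Complexification S)),
        HasDerivAt
          (fun s : ℂ => Ψ (Fin.cons (p.1 + algebraMap ℂ (Complexification S) s) p.2))
          (F (Ψ (Fin.cons p.1 p.2))) 0 := by
  obtain ⟨c, hc⟩ := hF
  have hFa : AnalyticAt ℂ F 0 := analyticAt_of_hasSum (by simpa using hc)
  have hFs : ∀ᶠ Z in 𝓝 (0 : Fin N → Complexification S), AnalyticAt ℂ F Z ∧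
      ∀ a h, fderiv ℂ F Z (a • h) = a • fderiv ℂ F Z h :=
    hFa.eventually_analyticAt.and (eventually_fderiv_smul_of_hasSum (by simpa using hc))
  have hsnd : Filter.Tendsto (Prod.snd : Complexification S × (Fin N → Complexification S) → _)
      (𝓝 0) (𝓝 0) := continuous_snd.tendsto 0
  have hf := analyticAt_suspension hFa
  -- At the origin the derivative sends `(a, v)` to `(0, a F(0))`, and a second application kills
  -- this.
  obtain ⟨G, φ, h⟩ := exists_isFlow hf (by simp [suspension]) (fun v => by
    rw [fderiv_suspension hFa.differentiableAt, fderiv_suspension hFa.differentiableAt]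
    simp)
  have hfs : ∀ a, IntertwinesAt (prodAction N a) (prodAction N a) (suspension F) 0 := by
    refine fun a => ⟨hf, ?_⟩
    filter_upwards [hsnd.eventually hFs] with x hx v
    rw [fderiv_suspension hx.1.differentiableAt, fderiv_suspension hx.1.differentiableAt]
    simp only [prodAction_apply, hx.2, mul_zero, smul_add, mul_smul]
    rw [smul_comm x.1 a]
  let one : Set.Icc (0 : ℝ) 1 := ⟨1, zero_le_one, le_rfl⟩
  let ev : Curve (Complexification S × (Fin N → Complexification S)) →L[ℂ]
      (Fin N → Complexification S) :=
    (ContinuousLinearMap.snd ℂ _ _).comp (ContinuousMap.evalCLM ℂ one)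
  have hcons0 : headTail S N 0 = 0 := map_zero _
  refine ⟨fun p => ev (φ (headTail S N p)), ?_, ?_, ?_⟩
  · refine sAnalyticAt_iff.2 fun a => ?_
    have h1 : IntertwinesAt (smulCLM (N + 1) a) (prodAction N a) (headTail S N) 0 :=
      IntertwinesAt.of_clm (headTail S N) (fun v => rfl) 0
    exact ((h.intertwinesAt (hfs a)).clm_comp ev (C := smulCLM N a) (fun u => rfl)).comp
      (f := headTail S N) (by simpa only [hcons0] using h1)
  · have hc0 : Filter.Tendsto (fun Z : Fin N → Complexification S =>
        ((0 : Complexification S), Z)) (𝓝 0) (𝓝 0) :=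
      (Continuous.prodMk continuous_const continuous_id).tendsto 0
    filter_upwards [hc0.eventually h.eq_const] with Z hZ
    change ev (φ (0, Z)) = Z
    rw [hZ (by simp [suspension])]
    rfl
  -- In the direction `(1, 0)` the derivative of the suspension is `g = (0, F)`, so at time one the
  -- flow has space derivative `F(Ψ)`.
  · have hder := h.fderiv_apply (g := fun x => (0, F x.2)) (v := (1, 0))
      (analyticAt_const.prod (AnalyticAt.comp (f := Prod.snd) hFa analyticAt_snd))
      (by
        filter_upwards [hsnd.eventually hFs] with x hx
        rw [fderiv_suspension hx.1.differentiableAt]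
        simp)
      (by
        filter_upwards [hsnd.eventually hFs] with x hx
        rw [fderiv_suspension hx.1.differentiableAt]
        have h1 : HasFDerivAt
            (fun x : Complexification S × (Fin N → Complexification S) => F x.2)
            ((fderiv ℂ F x.2).comp (ContinuousLinearMap.snd ℂ _ _)) x :=
          HasFDerivAt.comp (f := Prod.snd) x hx.1.differentiableAt.hasFDerivAt hasFDerivAt_snd
        rw [((hasFDerivAt_const (0 : Complexification S) x).prodMk h1).fderiv]
        -- The two fields commute because `T` can be taken out of the derivative of `F`, that is, by
        -- its linearity over the algebra.
        simp [suspension, hx.2])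
    filter_upwards [hder, h.analyticAt.eventually_analyticAt] with x h1 h2
    have d1 : HasDerivAt (fun s : ℂ => (x.1 + algebraMap ℂ (Complexification S) s, x.2))
        ((1 : Complexification S), (0 : Fin N → Complexification S)) 0 := by
      refine HasDerivAt.prodMk ?_ (hasDerivAt_const _ _)
      simp only [Algebra.algebraMap_eq_smul_one]
      simpa using ((hasDerivAt_id (0 : ℂ)).smul_const (1 : Complexification S)).const_add x.1
    have d2 : HasFDerivAt φ (fderiv ℂ φ x) (x.1 + algebraMap ℂ (Complexification S) 0, x.2) := by
      simpa using h2.differentiableAt.hasFDerivAt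
    have d3 := ev.hasFDerivAt.comp_hasDerivAt 0 (d2.comp_hasDerivAt 0 d1)
    refine HasDerivAt.congr_deriv (f := fun s : ℂ => ev (φ (x.1 + algebraMap ℂ _ s, x.2))) d3 ?_
    change (fderiv ℂ φ x (1, 0) one).2 = F (φ x one).2
    rw [h1]
    simp [one]

end AlgebraicTime

end CRAlg

end

theorem theorem4 {S : Type*} [CommRing S] [Algebra ℝ S] [FiniteDimensional ℝ S] {n k N : ℕ}
    (Q : CRAlg.ModelSurface n k) (hQ : Q.Nondegenerate)
    (ψ : CRAlg.Ambient n k ≃ₗ[ℂ] (Fin N → CRAlg.Complexification S)) :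
    -- (a) `aut Q` is a Lie algebra, and `aut_S Q` is a Lie subalgebra of it
    (∃ A : LieSubalgebra ℝ (CRAlg.HolField (CRAlg.Ambient n k)),
      (A : Set (CRAlg.HolField (CRAlg.Ambient n k))) = Q.aut ∧
      ∃ B : LieSubalgebra ℝ A, ∀ X : A, X ∈ B ↔ (X : CRAlg.HolField _) ∈ Q.autS ψ) ∧
    -- (b) `Aut_S Q` is a subgroup of the local group `Aut Q`, and the local group generated by
    -- `exp (aut_S Q)` is a subgroup of `Aut_S Q`
    (CRAlg.IsLocalSubgroup (Q.AutS ψ) Q.Aut ∧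
      CRAlg.IsLocalSubgroup (Q.expGroup (Q.autS ψ)) (Q.AutS ψ)) ∧
    -- the solution `Ψ(T, Z)` of an `S`-holomorphic equation `dζ/dt = F(ζ)`, `ζ(0) = Z`, is
    -- `S`-holomorphic in the time and the initial value
    (∀ F : (Fin N → CRAlg.Complexification S) → (Fin N → CRAlg.Complexification S),
      CRAlg.SHolomorphicNearZero F →
      ∃ Ψ : (Fin (N + 1) → CRAlg.Complexification S) → (Fin N → CRAlg.Complexification S),
        CRAlg.SHolomorphicNearZero Ψ ∧
        (∀ᶠ Z in 𝓝 (0 : Fin N → CRAlg.Complexification S), Ψ (Fin.cons 0 Z) = Z) ∧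
        ∀ᶠ p in 𝓝 (0 : CRAlg.Complexification S × (Fin N → CRAlg.Complexification S)),
          HasDerivAt
            (fun s : ℂ => Ψ (Fin.cons (p.1 + algebraMap ℂ (CRAlg.Complexification S) s) p.2))
            (F (Ψ (Fin.cons p.1 p.2))) 0) := by
  refine ⟨⟨Q.autLieSubalgebra, rfl, Q.autSLieSubalgebra ψ, fun X => Iff.rfl⟩,
    ⟨Q.isLocalSubgroup_AutS ψ, Q.isLocalSubgroup_expGroup_autS ψ⟩,
    fun F hF => CRAlg.exists_algebraic_flow hF⟩
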